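/- For a probability distribution $F$ on $Z_0=\{0,1,2,\dots\}$ with density $p$ and $F(k)=\sum_{j\le k}p(j)$ (so $F(-1)=0$), let \[ k_0(F)=\min\{k: F(k)\ge 0.5\},\qquad \mathrm{umed}(F)=k_0(F)-0.5+\frac{0.5-F(k_0(F)-1)}{p(k_0(F))} \] be its uniform median. Let $\Theta\subset\mathbb R$ be an interval and let $F_\theta$, $\theta\in\Theta$, be distributions on $Z_0$ with densities $p(\cdot,\theta)$ such that (A0) $p(k,\theta)>0$ for all $k\in Z_0$ and all $\theta$ in the interior of $\Theta$; (A1) for each $k\in Z_0$, $F_\theta(k)$ is a strictly decreasing function of $\theta\in\Theta$; (A2) for each $k\in Z_0$, $F_\theta(k)$ is a continuous function of $\theta\in\Theta$; (A3) for each $k\in Z_0$, $F_\theta(k)\to 1$ as $\theta\to\inf\Theta$ and $F_\theta(k)\to 0$ as $\theta\to\sup\Theta$. Assume that $p(k,\theta)$ is continuously differentiable in $\theta\in\Theta$ for each $k$. Fix $\theta\in\Theta$, let $x_1,x_2,\dots$ be i.i.d. with distribution $F_\theta$, let $F_n$ be the empirical distribution of $x_1,\dots,x_n$, and let the optimal estimator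 $\widehat\theta_n$ be a random variable that for each $n\ge1$ almost surely satisfies $\widehat\theta_n\in\Theta$ and $\mathrm{umed}(F_n)=\mathrm{umed}(F_{\widehat\theta_n})$ whenever this equation has a solution in $\Theta$. Put $g(t)=\mathrm{umed}(F_t)$ for $t\in\Theta$ and $K=k_0(F_\theta)$. (a) If $F_\theta(K)>0.5$, then $g$ is differentiable at $\theta$ (relative to $\Theta$) and, if $g'(\theta)\ne0$, \[ \sqrt n(\widehat\theta_n-\theta)\to_d N\Big(0,\frac{\sigma^2}{g'(\theta)^2}\Big),\qquad \sigma^2=\frac{0.25}{p_0^3}\big(4F^1(F^1-1+p_0)-p_0+1\big), \] where $p_0=p(K,\theta)$ and $F^1=F_\theta(K-1)$. (b) If $F_\theta(K)=0.5$, then $g$ has one-sided derivatives $g'_-$ (left) and $g'_+$ (right) at $\theta$, which are given by \[ g'_-=\frac{\partial}{\partial t}\left[\frac{0.5-F_t(K-1)}{p(K,t)}\right]_{t=\theta-},\qquad g'_+=\frac{\partial}{\partial t}\left[\frac{0.5-F_t(K)}{p(K+1,t)}\right]_{t=\theta+}, \] and, if $g'_-\neq0$ and $g'_+\ne0$, then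 $\sqrt n(\widehat\theta_n-\theta)\to_d G$, where $G$ is the probability law with distribution function \[ G(t)=\begin{cases}\Phi\big(2g'_-\,t\,p(K,\theta)\big)&\text{if }t\le0,\\ \Phi\big(2g'_+\,t\,p(K+1,\theta)\big)&\text{if }t>0,\end{cases} \] and $\Phi$ is the standard normal distribution function. -/

import Mathlib

open Filter Topology MeasureTheory ProbabilityTheory

noncomputable section

namespace UMed

/-- The distribution function `F(k) = ∑_{j ≤ k} p(j)` at an integer `k` (so `F(k) = 0` for `k < 0`)
of the distribution on the nonnegative integers with probability density `p`. -/
def distFun (p : ℕ → ℝ) (k : ℤ) : ℝ := ∑ j ∈ Finset.range (k + 1).toNat, p j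

/-- `k₀(F) = min {k : F(k) ≥ 1/2}`. -/
def k₀ (p : ℕ → ℝ) : ℕ := sInf {k : ℕ | 1 / 2 ≤ distFun p k}

/-- The uniform median `umed(F) = k₀ - 1/2 + (1/2 - F(k₀ - 1)) / p(k₀)`. -/
def umed (p : ℕ → ℝ) : ℝ := k₀ p - 1 / 2 + (1 / 2 - distFun p ((k₀ p : ℤ) - 1)) / p (k₀ p)

/-- The probability density (mass function) `k ↦ p(k)`, real valued, of a distribution on the
nonnegative integers. -/
def dens (P : PMF ℕ) (k : ℕ) : ℝ := (P k).toReal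

/-- The density `p_n(k) = #{i ≤ n : x_i = k} / n` of the empirical distribution of the first `n`
members of a sequence. -/
def empDens (x : ℕ → ℕ) (n : ℕ) (k : ℕ) : ℝ := ((Finset.range n).filter (fun i => x i = k)).card / n

/-- `σ² = (1/4) p₀⁻³ (4 F¹ (F¹ - 1 + p₀) - p₀ + 1)`, with `K = k₀(F)`, `p₀ = p(K)` and
`F¹ = F(K - 1)`. -/
def sigmaSq (p : ℕ → ℝ) : ℝ :=
  (1 / 4) / p (k₀ p) ^ 3 *
    (4 * distFun p ((k₀ p : ℤ) - 1) * (distFun p ((k₀ p : ℤ) - 1) - 1 + p (k₀ p)) - p (k₀ p) + 1)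

/-- `σ²` is nonnegative, so that it can serve as a variance. -/
theorem sigmaSq_nonneg (P : PMF ℕ) : 0 ≤ sigmaSq (dens P) := by
  have h0 : ∀ k, 0 ≤ dens P k := fun k => ENNReal.toReal_nonneg
  have hs : HasSum (dens P) 1 := by
    have h : ∑' k, P k ≠ ⊤ := by rw [P.tsum_coe]; exact ENNReal.one_ne_top
    have h2 := ENNReal.hasSum_toReal h
    rw [← ENNReal.tsum_toReal_eq (fun k => P.apply_ne_top k), P.tsum_coe] at h2
    exact h2
  have h1 := sum_le_hasSum (Finset.range (k₀ (dens P) + 1)) (fun i _ => h0 i) hs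
  rw [Finset.sum_range_succ] at h1
  unfold sigmaSq distFun
  have e : ((k₀ (dens P) : ℤ) - 1 + 1).toNat = k₀ (dens P) := by simp
  rw [e]
  have hF : 0 ≤ ∑ j ∈ Finset.range (k₀ (dens P)), dens P j := Finset.sum_nonneg fun i _ => h0 i
  have hp := h0 (k₀ (dens P))
  generalize (∑ j ∈ Finset.range (k₀ (dens P)), dens P j) = f at *
  generalize dens P (k₀ (dens P)) = q at *
  apply mul_nonneg (by positivity)
  rcases le_total (4 * f) 1 with h | h
  · nlinarith [mul_nonneg (sub_nonneg.2 h1) (sub_nonneg.2 h)]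
  · nlinarith [mul_nonneg hp (sub_nonneg.2 h), sq_nonneg (1 - 2 * f)]

/-- The standing assumptions on a one-parameter family `F_θ`, `θ ∈ Θ`, of distributions supported
on the nonnegative integers. The values `F t` for `t ∉ Θ` are irrelevant. -/
structure IsRegularFamily (Θ : Set ℝ) (F : ℝ → PMF ℕ) : Prop where
  /-- The parameter range is an interval. -/
  interval : Θ.OrdConnected
  /-- The support is the set of all nonnegative integers (an endpoint of the parameter range may
  be exceptional, as for the Poisson family with range `[0, ∞)`). -/
  support : ∀ t ∈ interior Θ, ∀ k : ℕ, 0 < dens (F t) k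
  /-- `F_θ(k)` is a decreasing function of `θ`. -/
  decreasing : ∀ k : ℕ, StrictAntiOn (fun t => distFun (dens (F t)) k) Θ
  /-- `F_θ(k)` is a continuous function of `θ`. -/
  continuous : ∀ k : ℕ, ContinuousOn (fun t => distFun (dens (F t)) k) Θ
  /-- `F_θ(k) → 1` as `θ` decreases to `inf Θ`. (The filter `atBot` on `Θ` is that of approach to
  the possibly infinite infimum; if `Θ` has a least element, it is evaluation there.) -/
  lim_inf : ∀ k : ℕ, Tendsto (fun t : Θ => distFun (dens (F t)) k) atBot (𝓝 1)
  /-- `F_θ(k) → 0` as `θ` increases to `sup Θ`. -/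
  lim_sup : ∀ k : ℕ, Tendsto (fun t : Θ => distFun (dens (F t)) k) atTop (𝓝 0)

/-- `θhat` solves `umed(F_n) = umed(F_θhat)` in `Θ`, where `F_n` has density `q`, provided that
there is a solution. (There may be none, e.g. when all observations are `0` and `inf Θ ∉ Θ`.) -/
def IsOptEstimate (Θ : Set ℝ) (F : ℝ → PMF ℕ) (q : ℕ → ℝ) (θhat : ℝ) : Prop :=
  (∃ t ∈ Θ, umed q = umed (dens (F t))) → θhat ∈ Θ ∧ umed q = umed (dens (F θhat))

/-- The standard normal distribution function. -/
def Phi (t : ℝ) : ℝ := cdf (gaussianReal 0 1) t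

/-- The function equal to `Φ(a t)` for `t ≤ 0` and to `Φ(b t)` for `t > 0`. -/
def twoSidedPhi (a b t : ℝ) : ℝ := if t ≤ 0 then Phi (a * t) else Phi (b * t)

end UMed

end

/-! The uniform median is the ordinary median of `X + U`, with `X` of law `F` and `U` uniform on
`[-1/2, 1/2]` independent of `X`. The distribution function `smoothDist p` of this sum is affine on
each cell `[m - 1/2, m + 1/2]` with slope `p m`, and `umed p ≤ u` iff `1/2 ≤ smoothDist p u`
(`umed_le_iff`). For the empirical law, `smoothDist` at `u` is the sample mean of `ramp u (x i)`
(`smoothDist_empDens`).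

Since `g` is strictly increasing, `θhat n ≤ s` becomes: the mean of `ramp (g s) (x i)` is at least
`1/2`. With `s = θ + t / √n` this is a central limit statement for bounded variables
(`tendsto_measure_le_sum`). Replacing `ramp (g s)` by `ramp (g θ)` costs a negligible fluctuation
and a drift `d * t`, where `d` is the derivative of `smoothDist (dens (F θ)) ∘ g` at `θ`. The limit
of the probabilities is thus the value at `d * t` of a centred normal distribution function with
variance that of `ramp (g θ) (x 0)`.

In (a), `d = g' p₀` and the variance is `p₀² σ²`. In (b), `g θ = K + 1/2` separates two cells, so
`d` depends on the sign of `t`, and the variance is `1/4`. The estimating equation is almost surely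
solvable for all large `n` (`ae_eventually_optEstimate`). Only a least element of `Θ` is a boundary
case: there the law is the point mass at `0`. -/

noncomputable section

namespace UMed

/-! ### The ramp and the smoothed distribution function. -/

/-- The function `k ↦ u - k + 1/2`, clipped to `[0, 1]`. -/
def ramp (u : ℝ) (k : ℕ) : ℝ := max 0 (min 1 (u + 1 / 2 - k))

/-- The value at `u` of the distribution function of `p` smoothed by a uniform variable on
`[-1/2, 1/2]`. -/
def smoothDist (p : ℕ → ℝ) (u : ℝ) : ℝ := ∑ k ∈ Finset.range ⌈u + 1 / 2⌉₊, p k * ramp u k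

theorem ramp_nonneg (u : ℝ) (k : ℕ) : 0 ≤ ramp u k := le_max_left _ _

theorem ramp_le_one (u : ℝ) (k : ℕ) : ramp u k ≤ 1 := max_le zero_le_one (min_le_left _ _)

theorem ramp_eq_zero {u : ℝ} {k : ℕ} (h : u + 1 / 2 ≤ k) : ramp u k = 0 :=
  max_eq_left ((min_le_right _ _).trans (by linarith))

theorem ramp_eq_one {u : ℝ} {k : ℕ} (h : (k : ℝ) + 1 ≤ u + 1 / 2) : ramp u k = 1 := by
  unfold ramp
  rw [min_eq_left (by linarith), max_eq_right zero_le_one]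

theorem ramp_mono (k : ℕ) : Monotone fun u => ramp u k := fun u v h => by
  exact max_le_max le_rfl (min_le_min le_rfl (by linarith))

theorem abs_ramp_sub_le (u v : ℝ) (k : ℕ) : |ramp u k - ramp v k| ≤ |u - v| := by
  unfold ramp
  calc _ ≤ |min 1 (u + 1 / 2 - k) - min 1 (v + 1 / 2 - k)| := by
        simpa using abs_max_sub_max_le_max 0 (min 1 (u + 1 / 2 - k)) 0 (min 1 (v + 1 / 2 - k))
    _ ≤ |(u + 1 / 2 - k) - (v + 1 / 2 - k)| := by
        simpa using abs_min_sub_min_le_max 1 (u + 1 / 2 - k) 1 (v + 1 / 2 - k)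
    _ = |u - v| := by ring_nf

theorem ramp_add (m : ℕ) {w : ℝ} (h0 : 0 ≤ w) (h1 : w ≤ 1) : ramp (m - 1 / 2 + w) m = w := by
  unfold ramp
  rw [show (m - 1 / 2 + w + 1 / 2 - m : ℝ) = w by ring, min_eq_right h1, max_eq_right h0]

/-- A general `f` serves both the mean (`f = id`) and the second moment (`f y = y ^ 2`) of the ramp.
-/
theorem sum_range_mul_ramp_eq (p : ℕ → ℝ) (f : ℝ → ℝ) (hf : f 0 = 0) {u : ℝ} {N : ℕ}
    (h : u + 1 / 2 ≤ N) :
    ∑ k ∈ Finset.range N, p k * f (ramp u k) =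
      ∑ k ∈ Finset.range ⌈u + 1 / 2⌉₊, p k * f (ramp u k) := by
  symm
  apply Finset.sum_subset
  · exact Finset.range_subset_range.2 (Nat.ceil_le.2 h)
  · intro k _ hk
    rw [ramp_eq_zero (Nat.ceil_le.1 (by simpa using hk)), hf, mul_zero]

theorem smoothDist_eq (p : ℕ → ℝ) {u : ℝ} {N : ℕ} (h : u + 1 / 2 ≤ N) :
    smoothDist p u = ∑ k ∈ Finset.range N, p k * ramp u k :=
  (sum_range_mul_ramp_eq p id rfl h).symm

theorem distFun_natCast (p : ℕ → ℝ) (m : ℕ) :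
    distFun p m = ∑ j ∈ Finset.range (m + 1), p j := by
  unfold distFun
  rw [show ((m : ℤ) + 1).toNat = m + 1 by omega]

theorem distFun_natCast_sub_one (p : ℕ → ℝ) (m : ℕ) :
    distFun p ((m : ℤ) - 1) = ∑ j ∈ Finset.range m, p j := by
  unfold distFun
  rw [show ((m : ℤ) - 1 + 1).toNat = m by omega]

theorem distFun_eq_add (p : ℕ → ℝ) (m : ℕ) : distFun p m = distFun p ((m : ℤ) - 1) + p m := by
  rw [distFun_natCast, distFun_natCast_sub_one, Finset.sum_range_succ]

theorem sum_range_succ_mul_ramp (p : ℕ → ℝ) (f : ℝ → ℝ) (hf : f 1 = 1) (m : ℕ) {w : ℝ}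
    (h0 : 0 ≤ w) (h1 : w ≤ 1) :
    ∑ k ∈ Finset.range (m + 1), p k * f (ramp (m - 1 / 2 + w) k) =
      distFun p ((m : ℤ) - 1) + f w * p m := by
  rw [Finset.sum_range_succ, ramp_add m h0 h1, distFun_natCast_sub_one, mul_comm (p m)]
  congr 1
  refine Finset.sum_congr rfl fun k hk => ?_
  have : (k : ℝ) + 1 ≤ m := by exact_mod_cast Finset.mem_range.1 hk
  rw [ramp_eq_one (by linarith), hf, mul_one]

theorem smoothDist_add (p : ℕ → ℝ) (m : ℕ) {w : ℝ} (h0 : 0 ≤ w) (h1 : w ≤ 1) :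
    smoothDist p (m - 1 / 2 + w) = distFun p ((m : ℤ) - 1) + w * p m := by
  rw [smoothDist_eq p (N := m + 1) (by push_cast; linarith)]
  exact sum_range_succ_mul_ramp p id rfl m h0 h1

theorem smoothDist_mono {p : ℕ → ℝ} (h0 : ∀ k, 0 ≤ p k) : Monotone (smoothDist p) := by
  intro u v h
  have hN : v + 1 / 2 ≤ (⌈v + 1 / 2⌉₊ : ℝ) := Nat.le_ceil _
  rw [smoothDist_eq p hN, smoothDist_eq p (u := u) (N := ⌈v + 1 / 2⌉₊) (by linarith)]
  exact Finset.sum_le_sum fun k _ => mul_le_mul_of_nonneg_left (ramp_mono k h) (h0 k)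

theorem exists_eq_sub_half_add {u : ℝ} (hu : -1 / 2 < u) :
    ∃ (m : ℕ) (w : ℝ), 0 < w ∧ w ≤ 1 ∧ u = m - 1 / 2 + w := by
  have h := Nat.ceil_lt_add_one (a := u + 1 / 2) (by linarith)
  have h' := Nat.le_ceil (u + 1 / 2)
  have hp : 0 < ⌈u + 1 / 2⌉₊ := Nat.ceil_pos.2 (by linarith)
  refine ⟨⌈u + 1 / 2⌉₊ - 1, u + 1 / 2 - (⌈u + 1 / 2⌉₊ - 1), by linarith, by linarith, ?_⟩
  rw [Nat.cast_pred hp]; ring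

/-! ### The uniform median as a median of the smoothed distribution. -/

theorem distFun_mono {p : ℕ → ℝ} (h0 : ∀ k, 0 ≤ p k) : Monotone (distFun p) := fun a b h =>
  Finset.sum_le_sum_of_subset_of_nonneg (Finset.range_subset_range.2 (by omega))
    fun k _ _ => h0 k

theorem distFun_k₀ {p : ℕ → ℝ} (h1 : ∃ k : ℕ, 1 / 2 ≤ distFun p k) :
    1 / 2 ≤ distFun p (k₀ p) := Nat.sInf_mem (s := {k : ℕ | 1 / 2 ≤ distFun p k}) h1

theorem distFun_k₀_sub_one_lt (p : ℕ → ℝ) : distFun p ((k₀ p : ℤ) - 1) < 1 / 2 := by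
  rcases Nat.eq_zero_or_pos (k₀ p) with h | h
  · rw [distFun_natCast_sub_one, h]; norm_num
  · have := Nat.notMem_of_lt_sInf (s := {k : ℕ | 1 / 2 ≤ distFun p k}) (m := k₀ p - 1)
      (Nat.sub_lt h one_pos)
    rw [show ((k₀ p : ℤ) - 1) = ((k₀ p - 1 : ℕ) : ℤ) by omega]
    simpa using this

theorem k₀_eq {p : ℕ → ℝ} (h0 : ∀ k, 0 ≤ p k) {K : ℕ} (h1 : 1 / 2 ≤ distFun p K)
    (h2 : distFun p ((K : ℤ) - 1) < 1 / 2) : k₀ p = K := by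
  refine le_antisymm (Nat.sInf_le h1) (le_csInf ⟨K, h1⟩ fun k hk => ?_)
  by_contra! hlt
  have : distFun p k ≤ distFun p ((K : ℤ) - 1) := distFun_mono h0 (by omega)
  have hk' : 1 / 2 ≤ distFun p k := hk
  linarith

theorem apply_k₀_pos {p : ℕ → ℝ} (h1 : ∃ k : ℕ, 1 / 2 ≤ distFun p k) : 0 < p (k₀ p) := by
  have := distFun_k₀ h1
  rw [distFun_eq_add] at this
  linarith [distFun_k₀_sub_one_lt p]

/-- The weight `w ∈ (0, 1]` with `umed p = k₀ - 1/2 + w`. -/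
theorem exists_umed_eq {p : ℕ → ℝ} (h1 : ∃ k : ℕ, 1 / 2 ≤ distFun p k) :
    ∃ w, 0 < w ∧ w ≤ 1 ∧ umed p = k₀ p - 1 / 2 + w ∧
      distFun p ((k₀ p : ℤ) - 1) + w * p (k₀ p) = 1 / 2 := by
  have hp := apply_k₀_pos h1
  have hlt := distFun_k₀_sub_one_lt p
  have hle := distFun_k₀ h1
  rw [distFun_eq_add] at hle
  refine ⟨(1 / 2 - distFun p ((k₀ p : ℤ) - 1)) / p (k₀ p), div_pos (by linarith) hp,
    (div_le_one hp).2 (by linarith), rfl, ?_⟩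
  rw [div_mul_cancel₀ _ hp.ne']; ring

theorem neg_half_lt_umed {p : ℕ → ℝ} (h1 : ∃ k : ℕ, 1 / 2 ≤ distFun p k) :
    -1 / 2 < umed p := by
  obtain ⟨w, hw, -, h, -⟩ := exists_umed_eq h1
  have : (0 : ℝ) ≤ k₀ p := Nat.cast_nonneg _
  linarith

theorem smoothDist_umed {p : ℕ → ℝ} (h1 : ∃ k : ℕ, 1 / 2 ≤ distFun p k) :
    smoothDist p (umed p) = 1 / 2 := by
  obtain ⟨w, hw, hw1, h, h'⟩ := exists_umed_eq h1
  rw [h, smoothDist_add p _ hw.le hw1, h']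

/-- Immediately to the left of `umed p` the smoothed distribution function has slope `p (k₀ p) > 0`,
so it is below `1/2` at every smaller point. -/
theorem umed_le_iff {p : ℕ → ℝ} (h0 : ∀ k, 0 ≤ p k) (h1 : ∃ k : ℕ, 1 / 2 ≤ distFun p k) (u : ℝ) :
    umed p ≤ u ↔ 1 / 2 ≤ smoothDist p u := by
  constructor
  · intro h
    rw [← smoothDist_umed h1]
    exact smoothDist_mono h0 h
  · intro h
    by_contra! hu
    obtain ⟨w, hw, hw1, e, e'⟩ := exists_umed_eq h1
    -- Moves `u` up to the left end of the cell of `umed p` if it lies further left, so that the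
    -- affine formula applies.
    set w' := max 0 (u - (k₀ p - 1 / 2))
    have hw' : w' < w := max_lt hw (by linarith)
    have hu' : u ≤ k₀ p - 1 / 2 + w' := by
      linarith [le_max_right 0 (u - (k₀ p - 1 / 2 : ℝ))]
    have := h.trans (smoothDist_mono h0 hu')
    rw [smoothDist_add p _ (le_max_left _ _) (by linarith)] at this
    have := mul_lt_mul_of_pos_right hw' (apply_k₀_pos h1)
    linarith

/-- With all masses positive, `smoothDist p` is strictly increasing to the right of `-1/2`, so its
median is unique. -/
theorem umed_eq_of_smoothDist_eq {p : ℕ → ℝ} (h0 : ∀ k, 0 < p k)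
    (h1 : ∃ k : ℕ, 1 / 2 ≤ distFun p k) {u : ℝ} (hu : -1 / 2 < u) (h : smoothDist p u = 1 / 2) :
    umed p = u := by
  refine le_antisymm ((umed_le_iff (fun k => (h0 k).le) h1 u).2 h.ge) ?_
  obtain ⟨m, w, hw, hw1, rfl⟩ := exists_eq_sub_half_add hu
  by_contra! hlt
  set w' := max 0 (umed p - (m - 1 / 2))
  have hw' : w' < w := max_lt hw (by linarith)
  have hu' : umed p ≤ m - 1 / 2 + w' := by
    linarith [le_max_right 0 (umed p - (m - 1 / 2 : ℝ))]
  have := (umed_le_iff (fun k => (h0 k).le) h1 _).1 hu'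
  rw [smoothDist_add p _ (le_max_left _ _) (by linarith)] at this
  rw [smoothDist_add p _ hw.le hw1] at h
  have := mul_lt_mul_of_pos_right hw' (h0 m)
  linarith

/-! ### Densities of laws and of samples. -/

theorem dens_nonneg (Q : PMF ℕ) (k : ℕ) : 0 ≤ dens Q k := ENNReal.toReal_nonneg

theorem hasSum_dens (Q : PMF ℕ) : HasSum (dens Q) 1 := by
  have h : ∑' k, Q k ≠ ⊤ := by rw [Q.tsum_coe]; exact ENNReal.one_ne_top
  have h2 := ENNReal.hasSum_toReal h
  rwa [← ENNReal.tsum_toReal_eq (fun k => Q.apply_ne_top k), Q.tsum_coe] at h2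

theorem exists_half_le_distFun {p : ℕ → ℝ} (h : HasSum p 1) : ∃ k : ℕ, 1 / 2 ≤ distFun p k := by
  have h2 := (tendsto_add_atTop_iff_nat 1).2 h.tendsto_sum_nat
  obtain ⟨k, hk⟩ := (h2.eventually_const_le (show (1 / 2 : ℝ) < 1 by norm_num)).exists
  exact ⟨k, by rwa [distFun_natCast]⟩

theorem exists_half_le_distFun_dens (Q : PMF ℕ) : ∃ k : ℕ, 1 / 2 ≤ distFun (dens Q) k :=
  exists_half_le_distFun (hasSum_dens Q)

theorem empDens_nonneg (x : ℕ → ℕ) (n k : ℕ) : 0 ≤ empDens x n k := by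
  unfold empDens; positivity

theorem empDens_eq_sum (x : ℕ → ℕ) (n k : ℕ) :
    empDens x n k = (∑ i ∈ Finset.range n, if x i = k then (1 : ℝ) else 0) / n := by
  rw [empDens, Finset.sum_boole]

theorem hasSum_empDens (x : ℕ → ℕ) {n : ℕ} (hn : 1 ≤ n) : HasSum (empDens x n) 1 := by
  have h : HasSum (fun k => ∑ i ∈ Finset.range n, if x i = k then (1 : ℝ) else 0)
      (∑ i ∈ Finset.range n, 1) :=
    hasSum_sum fun i _ => by simpa [eq_comm] using hasSum_ite_eq (x i) (1 : ℝ)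
  have h2 := h.div_const (n : ℝ)
  have hn' : (n : ℝ) ≠ 0 := by positivity
  simp only [Finset.sum_const, Finset.card_range, nsmul_eq_mul, mul_one, div_self hn'] at h2
  exact h2.congr_fun fun k => empDens_eq_sum x n k

theorem smoothDist_empDens (x : ℕ → ℕ) (n : ℕ) (u : ℝ) :
    smoothDist (empDens x n) u = (∑ i ∈ Finset.range n, ramp u (x i)) / n := by
  unfold smoothDist
  simp_rw [empDens_eq_sum, div_mul_eq_mul_div, ← Finset.sum_div, Finset.sum_mul]
  rw [Finset.sum_comm]
  congr 1
  refine Finset.sum_congr rfl fun i _ => ?_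
  simp only [ite_mul, one_mul, zero_mul, Finset.sum_ite_eq, Finset.mem_range]
  split_ifs with h
  · rfl
  · exact (ramp_eq_zero (Nat.ceil_le.1 (not_lt.1 h))).symm

/-! ### Convergence in distribution and a central limit theorem with varying summands. -/

section Probability

variable {Ω : Type*} [MeasurableSpace Ω] {P : Measure Ω} [IsProbabilityMeasure P]

/-- Half-open intervals form a π-system containing small neighbourhoods of every point, and their
measures are differences of values of the distribution function. -/
theorem tendstoInDistribution_of_tendsto_measure_le {X : ℕ → Ω → ℝ}
    (hX : ∀ n, AEMeasurable (X n) P) (G : Measure ℝ) [IsProbabilityMeasure G]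
    (h : ∀ t, Tendsto (fun n => P {ω | X n ω ≤ t}) atTop (𝓝 (G (Set.Iic t)))) :
    TendstoInDistribution X atTop (id : ℝ → ℝ) (fun _ => P) G where
  forall_aemeasurable := hX
  tendsto := by
    refine IsPiSystem.tendsto_probabilityMeasure_of_tendsto_of_mem
      (S := {s | ∃ a b : ℝ, a ≤ b ∧ s = Set.Ioc a b ∨ s = ∅}) ?_ ?_ ?_ ?_
    · rintro s ⟨a, b, ⟨hab, rfl⟩ | rfl⟩ t ⟨c, d, ⟨hcd, rfl⟩ | rfl⟩ hne
      · rw [Set.Ioc_inter_Ioc] at hne ⊢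
        exact ⟨_, _, .inl ⟨(Set.nonempty_Ioc.1 hne).le, rfl⟩⟩
      all_goals simp at hne
    · rintro s ⟨a, b, ⟨-, rfl⟩ | rfl⟩
      exacts [measurableSet_Ioc, MeasurableSet.empty]
    · intro u hu x hx
      obtain ⟨ε, hε, hball⟩ := Metric.isOpen_iff.1 hu x hx
      refine ⟨Set.Ioc (x - ε / 2) (x + ε / 2), ⟨_, _, .inl ⟨by linarith, rfl⟩⟩,
        Ioc_mem_nhds (by linarith) (by linarith), fun y hy => hball ?_⟩
      rw [Metric.mem_ball, Real.dist_eq, abs_lt]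
      constructor <;> linarith [hy.1, hy.2]
    · rintro s ⟨a, b, ⟨hab, rfl⟩ | rfl⟩
      · rw [← NNReal.tendsto_coe]
        have key (μ : Measure ℝ) [IsProbabilityMeasure μ] :
            (μ (Set.Ioc a b)).toReal = (μ (Set.Iic b)).toReal - (μ (Set.Iic a)).toReal := by
          have : Set.Ioc a b = Set.Iic b \ Set.Iic a := by ext; simp [and_comm]
          rw [this]
          exact measureReal_sdiff (Set.Iic_subset_Iic.2 hab) measurableSet_Iic
        have hlim (t : ℝ) : Tendsto (fun n => (P.map (X n) (Set.Iic t)).toReal) atTop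
            (𝓝 (G (Set.Iic t)).toReal) := by
          refine (ENNReal.tendsto_toReal (measure_ne_top _ _)).comp ((h t).congr fun n => ?_)
          rw [Measure.map_apply_of_aemeasurable (hX n) measurableSet_Iic]
          rfl
        have (n : ℕ) := Measure.isProbabilityMeasure_map (hX n)
        have h3 := (hlim b).sub (hlim a)
        rw [← key G] at h3
        simp only [Measure.map_id]
        exact h3.congr fun n => (key (P.map (X n))).symm
      · simp

/-- The tail unions of the symmetric differences decrease to a null set. -/
theorem tendsto_measure_of_ae_eventually_iff {s t : ℕ → Set Ω}
    (hs : ∀ n, NullMeasurableSet (s n) P) (ht : ∀ n, NullMeasurableSet (t n) P)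
    (h : ∀ᵐ ω ∂P, ∀ᶠ n in atTop, (ω ∈ s n ↔ ω ∈ t n)) {l : ENNReal}
    (hl : Tendsto (fun n => P (t n)) atTop (𝓝 l)) : Tendsto (fun n => P (s n)) atTop (𝓝 l) := by
  set d : ℕ → Set Ω := fun N => ⋃ n ≥ N, (s n \ t n ∪ t n \ s n) with hd
  have hmeas (N : ℕ) : NullMeasurableSet (d N) P :=
    .iUnion fun n => .iUnion fun _ => ((hs n).diff (ht n)).union ((ht n).diff (hs n))
  have hanti : Antitone d := fun a b hab => Set.biUnion_subset_biUnion_left fun n hn => hab.trans hn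
  have hlim := tendsto_measure_iInter_atTop hmeas hanti ⟨0, measure_ne_top P _⟩
  have h0 : P (⋂ N, d N) = 0 := by
    rw [measure_eq_zero_iff_ae_notMem]
    filter_upwards [h] with ω hω hmem
    obtain ⟨N, hN⟩ := eventually_atTop.1 hω
    have := Set.mem_iInter.1 hmem N
    simp only [hd, Set.mem_iUnion, Set.mem_union, Set.mem_sdiff] at this
    obtain ⟨n, hn, hh⟩ := this
    have := hN n hn
    tauto
  rw [h0] at hlim
  have h1 (n : ℕ) : P (s n) ≤ P (t n) + P (d n) :=
    (measure_mono fun ω hω => by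
      by_cases hb : ω ∈ t n
      · exact .inl hb
      · exact .inr (Set.mem_biUnion (le_refl n) (.inl ⟨hω, hb⟩))).trans (measure_union_le _ _)
  have h2 (n : ℕ) : P (t n) - P (d n) ≤ P (s n) := by
    rw [tsub_le_iff_right]
    exact (measure_mono fun ω hω => by
      by_cases hb : ω ∈ s n
      · exact .inl hb
      · exact .inr (Set.mem_biUnion (le_refl n) (.inr ⟨hω, hb⟩))).trans (measure_union_le _ _)
  have hl' : l ≠ ⊤ := ne_top_of_le_ne_top ENNReal.one_ne_top
    (le_of_tendsto hl (.of_forall fun n => prob_le_one))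
  refine tendsto_of_tendsto_of_tendsto_of_le_of_le ?_ ?_ h2 h1
  · simpa using ENNReal.Tendsto.sub hl hlim (.inl hl')
  · simpa using hl.add hlim

variable {E : Type*} [MeasurableSpace E] {x : ℕ → Ω → E}

theorem memLp_comp_of_bounded {Y : Ω → E} (hY : AEMeasurable Y P) {f : E → ℝ} (hf : Measurable f)
    {C : ℝ} (hC : ∀ k, |f k| ≤ C) (p : ENNReal) : MemLp (fun ω => f (Y ω)) p P :=
  .of_bound (hf.comp_aemeasurable hY).aestronglyMeasurable C (.of_forall fun _ => hC _)

/-- By independence the normalized sum has variance at most `ε n ^ 2`; Chebyshev's inequality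
concludes. -/
theorem tendstoInMeasure_sum_of_bound_tendsto_zero (hx : ∀ i, IdentDistrib (x i) (x 0) P P)
    (hindep : iIndepFun x P) {h : ℕ → E → ℝ} (hh : ∀ n, Measurable (h n)) {ε : ℕ → ℝ}
    (hε : ∀ n k, |h n k| ≤ ε n) (hε0 : Tendsto ε atTop (𝓝 0)) :
    TendstoInMeasure P
      (fun (n : ℕ) ω => (√n)⁻¹ * (∑ i ∈ Finset.range n, h n (x i ω) - n * (∫ ω, h n (x 0 ω) ∂P)))
      atTop (fun _ => 0) := by
  have hL (n i : ℕ) : MemLp (fun ω => h n (x i ω)) 2 P :=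
    memLp_comp_of_bounded (hx i).aemeasurable_fst (hh n) (hε n) 2
  have hid (n i : ℕ) : IdentDistrib (fun ω => h n (x i ω)) (fun ω => h n (x 0 ω)) P P :=
    (hx i).comp (hh n)
  have hvar (n : ℕ) : Var[fun ω => h n (x 0 ω); P] ≤ ε n ^ 2 := by
    have := variance_le_sq_of_bounded (μ := P) (X := fun ω => h n (x 0 ω)) (a := -ε n) (b := ε n)
      (.of_forall fun ω => abs_le.1 (hε n _)) (hL n 0).aemeasurable
    calc _ ≤ _ := this
      _ = ε n ^ 2 := by ring
  set S : ℕ → Ω → ℝ := fun n => ∑ i ∈ Finset.range n, fun ω => h n (x i ω) with hS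
  have hSL (n : ℕ) : MemLp (S n) 2 P := memLp_finsetSum' _ fun i _ => hL n i
  have hSvar (n : ℕ) : Var[S n; P] = n * Var[fun ω => h n (x 0 ω); P] := by
    rw [hS]
    simp only
    rw [IndepFun.variance_sum (fun i _ => hL n i) fun i _ j _ hij =>
      (hindep.indepFun hij).comp (hh n) (hh n)]
    simp [fun i => (hid n i).variance_eq]
  have hSint (n : ℕ) : (∫ ω, S n ω ∂P) = n * (∫ ω, h n (x 0 ω) ∂P) := by
    simp only [hS, Finset.sum_apply]
    rw [integral_finsetSum _ fun i _ => (hL n i).integrable (by norm_num)]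
    simp [fun i => (hid n i).integral_eq]
  rw [tendstoInMeasure_iff_norm]
  intro δ hδ
  have hbound : ∀ᶠ n : ℕ in atTop, P {ω | δ ≤ ‖(√n)⁻¹ * (∑ i ∈ Finset.range n, h n (x i ω) -
      n * (∫ ω, h n (x 0 ω) ∂P)) - 0‖} ≤ ENNReal.ofReal (ε n ^ 2 / δ ^ 2) := by
    filter_upwards [eventually_ge_atTop 1] with n hn
    have hn' : (0 : ℝ) < √n := Real.sqrt_pos.2 (by exact_mod_cast hn)
    have hc := meas_ge_le_variance_div_sq (hSL n) (c := δ * √n) (by positivity)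
    refine le_trans (le_of_eq ?_) (hc.trans (ENNReal.ofReal_le_ofReal ?_))
    · congr 1
      ext ω
      simp only [Set.mem_ofPred_eq, sub_zero, norm_mul, norm_inv, Real.norm_eq_abs,
        abs_of_pos hn', hSint]
      rw [inv_mul_eq_div, le_div_iff₀ hn']
      simp [hS]
    · rw [hSvar, mul_pow, Real.sq_sqrt (by positivity), mul_comm (n : ℝ),
        mul_div_mul_right _ _ (by positivity)]
      gcongr
      exact hvar n
  refine tendsto_of_tendsto_of_tendsto_of_le_of_le' tendsto_const_nhds ?_
    (.of_forall fun _ => zero_le) hbound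
  have := ((hε0.pow 2).div_const (δ ^ 2))
  simpa [Function.comp_def] using (ENNReal.continuous_ofReal.tendsto _).comp this

theorem gaussianReal_Ici_neg (v : NNReal) (c : ℝ) :
    gaussianReal 0 v (Set.Ici (-c)) = gaussianReal 0 v (Set.Iic c) := by
  have h := gaussianReal_map_neg (μ := 0) (v := v)
  rw [neg_zero] at h
  conv_lhs => rw [← h]
  rw [Measure.map_apply measurable_neg measurableSet_Ici]
  congr 1
  ext; simp

/-- The normalized sum splits into the classical term for `f₀`, the centred fluctuation of `f n -
f₀`, which vanishes in probability, and a deterministic drift tending to `c`. Slutsky's theorem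
gives the limit `Z + c`, and `Z + c ≥ 0` has the probability of `Z ≤ c` by symmetry. -/
theorem tendsto_measure_le_sum (hx : ∀ i, IdentDistrib (x i) (x 0) P P)
    (hindep : iIndepFun x P) {f : ℕ → E → ℝ} {f₀ : E → ℝ} (hf : ∀ n, Measurable (f n))
    (hf₀ : Measurable f₀) {C : ℝ} (hC : ∀ k, |f₀ k| ≤ C)
    {ε : ℕ → ℝ} (hε : ∀ n k, |f n k - f₀ k| ≤ ε n) (hε0 : Tendsto ε atTop (𝓝 0))
    (hV : Var[fun ω => f₀ (x 0 ω); P] ≠ 0) {c : ℝ}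
    (hc : Tendsto (fun n : ℕ => √n * ((∫ ω, f n (x 0 ω) ∂P) - (∫ ω, f₀ (x 0 ω) ∂P))) atTop
      (𝓝 c)) :
    Tendsto (fun n : ℕ => P {ω | n * (∫ ω, f₀ (x 0 ω) ∂P) ≤ ∑ i ∈ Finset.range n, f n (x i ω)})
      atTop (𝓝 (gaussianReal 0 Var[fun ω => f₀ (x 0 ω); P].toNNReal (Set.Iic c))) := by
  set V := Var[fun ω => f₀ (x 0 ω); P].toNNReal with hVdef
  have hV' : V ≠ 0 := by
    rw [hVdef, Ne, Real.toNNReal_eq_zero, not_le]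
    exact lt_of_le_of_ne (variance_nonneg _ _) hV.symm
  have := nullSingletonClass_gaussianReal (μ := 0) hV'
  have hm (i : ℕ) : AEMeasurable (x i) P := (hx i).aemeasurable_fst
  have hclt := tendstoInDistribution_inv_sqrt_mul_sum_sub (P := P)
    (X := fun i ω => f₀ (x i ω)) (HasLaw.id (μ := gaussianReal 0 V))
    (memLp_comp_of_bounded (hm 0) hf₀ hC 2) (hindep.comp (fun _ => f₀) fun _ => hf₀)
    fun i => (hx i).comp hf₀
  have hR := tendstoInMeasure_sum_of_bound_tendsto_zero hx hindep
    (h := fun n k => f n k - f₀ k) (fun n => (hf n).sub hf₀) hε hε0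
  have hd : TendstoInMeasure P (fun (n : ℕ) (_ : Ω) =>
      √n * ((∫ ω, f n (x 0 ω) ∂P) - (∫ ω, f₀ (x 0 ω) ∂P))) atTop (fun _ => c) :=
    tendstoInMeasure_of_tendsto_ae (fun n => aestronglyMeasurable_const) (.of_forall fun _ => hc)
  have hmR (n : ℕ) : AEMeasurable (fun ω => (√n)⁻¹ * (∑ i ∈ Finset.range n,
      (f n (x i ω) - f₀ (x i ω)) - n * (∫ ω, f n (x 0 ω) - f₀ (x 0 ω) ∂P))) P := by
    refine ((Finset.aemeasurable_fun_sum _ fun i _ => ?_).sub_const _).const_mul _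
    exact ((hf n).comp_aemeasurable (hm i)).sub (hf₀.comp_aemeasurable (hm i))
  have hsum := (hclt.add_of_tendstoInMeasure_const hR hmR).add_of_tendstoInMeasure_const hd
    fun n => aemeasurable_const
  -- The frontier `{0}` is null for the law of `Z + c` because the variance is nonzero.
  have hport := ProbabilityMeasure.tendsto_measure_of_null_frontier_of_tendsto' hsum.tendsto
    (E := Set.Ici 0) (by
      rw [frontier_Ici]
      simp only [ProbabilityMeasure.coe_mk, id, add_zero]
      rw [Measure.map_apply (by fun_prop) (measurableSet_singleton _)]
      have : (fun y : ℝ => y + c) ⁻¹' {0} = {-c} := by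
        ext y; simp [eq_neg_iff_add_eq_zero]
      rw [this, measure_singleton])
  simp only [ProbabilityMeasure.coe_mk, id, add_zero] at hport
  rw [Measure.map_apply (by fun_prop) measurableSet_Ici] at hport
  have e : (fun y : ℝ => y + c) ⁻¹' Set.Ici 0 = Set.Ici (-c) := by
    ext y; simp [neg_le_iff_add_nonneg]
  rw [e, gaussianReal_Ici_neg] at hport
  refine hport.congr' ?_
  filter_upwards [eventually_ge_atTop 1] with n hn
  rw [Measure.map_apply_of_aemeasurable (hsum.forall_aemeasurable n) measurableSet_Ici]
  congr 1
  ext ω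
  have hn' : (0 : ℝ) < √n := Real.sqrt_pos.2 (by exact_mod_cast hn)
  have hbdd : ∀ k, |f n k| ≤ C + ε n := fun k => by
    have := abs_add_le (f₀ k) (f n k - f₀ k)
    rw [add_sub_cancel] at this
    linarith [hC k, hε n k]
  have hint : (∫ ω, f n (x 0 ω) - f₀ (x 0 ω) ∂P) =
      (∫ ω, f n (x 0 ω) ∂P) - (∫ ω, f₀ (x 0 ω) ∂P) :=
    integral_sub ((memLp_comp_of_bounded (hm 0) (hf n) hbdd 1).integrable le_rfl)
      ((memLp_comp_of_bounded (hm 0) hf₀ hC 1).integrable le_rfl)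
  simp only [Set.mem_preimage, Set.mem_Ici, Pi.add_apply, Set.mem_ofPred_eq, hint,
    Finset.sum_sub_distrib]
  have hs : (√n)⁻¹ * (n : ℝ) = √n := by
    rw [inv_mul_eq_div, div_eq_iff hn'.ne', Real.mul_self_sqrt (by positivity)]
  generalize (∫ ω, f n (x 0 ω) ∂P) = a
  generalize (∫ ω, f₀ (x 0 ω) ∂P) = b
  generalize ∑ i ∈ Finset.range n, f n (x i ω) = A
  generalize ∑ i ∈ Finset.range n, f₀ (x i ω) = B
  have : (√n)⁻¹ * (B - n * b) + (√n)⁻¹ * (A - B - n * (a - b)) + √n * (a - b) =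
      (√n)⁻¹ * (A - n * b) := by
    linear_combination -(a - b) * hs
  rw [this, mul_nonneg_iff_of_pos_left (inv_pos.2 hn'), sub_nonneg]

end Probability

/-! ### The point mass at zero, and monotone families. -/

theorem distFun_dens_le_one (Q : PMF ℕ) (k : ℤ) : distFun (dens Q) k ≤ 1 :=
  sum_le_hasSum _ (fun i _ => dens_nonneg Q i) (hasSum_dens Q)

theorem dens_eq_zero_of_dens_zero_eq_one {Q : PMF ℕ} (h : dens Q 0 = 1) {k : ℕ} (hk : k ≠ 0) :
    dens Q k = 0 := by
  have := sum_le_hasSum {0, k} (fun i _ => dens_nonneg Q i) (hasSum_dens Q)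
  rw [Finset.sum_pair hk.symm, h] at this
  linarith [dens_nonneg Q k]

theorem k₀_eq_zero_of_dens_zero_eq_one {Q : PMF ℕ} (h : dens Q 0 = 1) : k₀ (dens Q) = 0 := by
  refine k₀_eq (dens_nonneg Q) ?_ ?_
  · rw [distFun_natCast]; norm_num [h]
  · rw [distFun_natCast_sub_one]; norm_num

theorem sigmaSq_eq_zero_of_dens_zero_eq_one {Q : PMF ℕ} (h : dens Q 0 = 1) :
    sigmaSq (dens Q) = 0 := by
  rw [sigmaSq, k₀_eq_zero_of_dens_zero_eq_one h, h, distFun_natCast_sub_one]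
  norm_num

theorem umed_eq_of_k₀_eq {p : ℕ → ℝ} {m : ℕ} (h : k₀ p = m) :
    umed p = m - 1 / 2 + (1 / 2 - distFun p ((m : ℤ) - 1)) / p m := by
  rw [umed, h]

theorem umed_mem_of_k₀_eq {p : ℕ → ℝ} (h1 : ∃ k : ℕ, 1 / 2 ≤ distFun p k) {m : ℕ}
    (h : k₀ p = m) : (m : ℝ) - 1 / 2 ≤ umed p ∧ umed p ≤ m + 1 / 2 := by
  obtain ⟨w, hw, hw1, e, -⟩ := exists_umed_eq h1
  rw [h] at e
  constructor <;> linarith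

/-- `smoothDist q` has kinks at cell ends, but as long as `g` stays in one closed cell only the
slope `q m` matters. This also covers one-sided derivatives at a kink. -/
theorem hasDerivWithinAt_smoothDist_comp (q : ℕ → ℝ) {g : ℝ → ℝ} {g' θ : ℝ} {S : Set ℝ} (m : ℕ)
    (hg : HasDerivWithinAt g g' S θ)
    (hS : ∀ᶠ t in 𝓝[S] θ, (m : ℝ) - 1 / 2 ≤ g t ∧ g t ≤ m + 1 / 2)
    (hθ : (m : ℝ) - 1 / 2 ≤ g θ ∧ g θ ≤ m + 1 / 2) :
    HasDerivWithinAt (fun t => smoothDist q (g t)) (g' * q m) S θ := by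
  have key : ∀ t, ((m : ℝ) - 1 / 2 ≤ g t ∧ g t ≤ m + 1 / 2) → smoothDist q (g t) =
      distFun q ((m : ℤ) - 1) + (g t - (m - 1 / 2)) * q m := fun t ht => by
    rw [← smoothDist_add q m (by linarith [ht.1]) (by linarith [ht.2])]
    congr 1; ring
  exact (((hg.sub_const _).mul_const (q m)).const_add _).congr_of_eventuallyEq
    (hS.mono key) (key θ hθ)

section Family

variable {Θ : Set ℝ} {F : ℝ → PMF ℕ}

/-- The value is the convex combination of `F(m - 1)` and `F(m)` with weights `1 - w` and `w > 0`.
-/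
theorem IsRegularFamily.smoothDist_lt (hF : IsRegularFamily Θ F) {s t : ℝ} (hs : s ∈ Θ)
    (ht : t ∈ Θ) (hst : s < t) {u : ℝ} (hu : -1 / 2 < u) :
    smoothDist (dens (F t)) u < smoothDist (dens (F s)) u := by
  obtain ⟨m, w, hw, hw1, rfl⟩ := exists_eq_sub_half_add hu
  rw [smoothDist_add _ m hw.le hw1, smoothDist_add _ m hw.le hw1]
  have h1 : distFun (dens (F t)) ((m : ℤ) - 1) ≤ distFun (dens (F s)) ((m : ℤ) - 1) := by
    rcases Nat.eq_zero_or_pos m with rfl | hm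
    · rw [distFun_natCast_sub_one, distFun_natCast_sub_one]; simp
    · rw [show ((m : ℤ) - 1) = ((m - 1 : ℕ) : ℤ) by omega]
      exact (hF.decreasing (m - 1) hs ht hst).le
  have h2 : distFun (dens (F t)) m < distFun (dens (F s)) m := hF.decreasing m hs ht hst
  rw [distFun_eq_add, distFun_eq_add] at h2
  nlinarith

theorem IsRegularFamily.strictMonoOn_umed (hF : IsRegularFamily Θ F) :
    StrictMonoOn (fun t => umed (dens (F t))) Θ := by
  intro s hs t ht hst
  have h := hF.smoothDist_lt hs ht hst (neg_half_lt_umed (exists_half_le_distFun_dens (F t)))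
  rw [smoothDist_umed (exists_half_le_distFun_dens _)] at h
  refine lt_of_le_of_ne
    ((umed_le_iff (dens_nonneg _) (exists_half_le_distFun_dens _) _).2 h.le) fun e => ?_
  simp only at e
  rw [← e, smoothDist_umed (exists_half_le_distFun_dens _)] at h
  exact lt_irrefl _ h

/-- At a greatest element of `Θ` all `F_θ(k)` would be `0`, which no distribution allows. -/
theorem IsRegularFamily.exists_gt (hF : IsRegularFamily Θ F) {θ : ℝ} (hθ : θ ∈ Θ) :
    ∃ b ∈ Θ, θ < b := by
  have : Nonempty Θ := ⟨⟨θ, hθ⟩⟩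
  obtain ⟨k, hk⟩ := exists_half_le_distFun_dens (F θ)
  obtain ⟨a, ha⟩ := eventually_atTop.1
    ((hF.lim_sup k).eventually_lt_const (show (0 : ℝ) < 1 / 2 by norm_num))
  refine ⟨a, a.2, lt_of_not_ge fun h => ?_⟩
  have := ha ⟨θ, hθ⟩ h
  simp only at this
  linarith

theorem IsRegularFamily.exists_lt_or (hF : IsRegularFamily Θ F) {θ : ℝ} (hθ : θ ∈ Θ) :
    (∃ a ∈ Θ, a < θ) ∨ dens (F θ) 0 = 1 := by
  have : Nonempty Θ := ⟨⟨θ, hθ⟩⟩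
  by_contra! h
  have hle := distFun_dens_le_one (F θ) (0 : ℕ)
  have e : distFun (dens (F θ)) (0 : ℕ) = dens (F θ) 0 := by rw [distFun_natCast]; simp
  obtain ⟨a, ha⟩ := eventually_atBot.1
    ((hF.lim_inf 0).eventually_const_lt (lt_of_le_of_ne (e ▸ hle) h.2))
  have := ha ⟨θ, hθ⟩ (h.1 a a.2)
  simp only at this
  linarith

theorem IsRegularFamily.mem_interior (hF : IsRegularFamily Θ F) {a b t : ℝ} (ha : a ∈ Θ)
    (hb : b ∈ Θ) (hat : a < t) (htb : t < b) : t ∈ interior Θ :=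
  interior_mono (Set.Ioo_subset_Icc_self.trans (hF.interval.out ha hb))
    (by rw [interior_Ioo]; exact ⟨hat, htb⟩)

/-- The intermediate value theorem is applied to `t ↦ smoothDist (dens (F t)) y` with `y` fixed, so
continuity of `umed` in `t` is not required. -/
theorem IsRegularFamily.exists_umed_eq (hF : IsRegularFamily Θ F)
    (hC : ∀ k, ContinuousOn (fun t => dens (F t) k) Θ) {a b : ℝ} (ha : a ∈ interior Θ)
    (hb : b ∈ interior Θ) (hab : a ≤ b) {y : ℝ} (h1 : umed (dens (F a)) ≤ y)
    (h2 : y ≤ umed (dens (F b))) : ∃ t ∈ Θ, y = umed (dens (F t)) := by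
  have hsub : Set.Icc a b ⊆ interior Θ := fun t ht => by
    rcases ht.1.eq_or_lt with rfl | hat
    · exact ha
    rcases ht.2.eq_or_lt with rfl | htb
    · exact hb
    exact hF.mem_interior (interior_subset ha) (interior_subset hb) hat htb
  have hcont : ContinuousOn (fun t => smoothDist (dens (F t)) y) (Set.Icc a b) :=
    continuousOn_finsetSum _ fun k _ =>
      ((hC k).mono (hsub.trans interior_subset)).mul continuousOn_const
  have ha' := (umed_le_iff (dens_nonneg _) (exists_half_le_distFun_dens (F a)) y).1 h1
  have hb' : smoothDist (dens (F b)) y ≤ 1 / 2 := by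
    rw [← smoothDist_umed (exists_half_le_distFun_dens (F b))]
    exact smoothDist_mono (dens_nonneg _) h2
  obtain ⟨t, ht, hty⟩ := intermediate_value_Icc' hab hcont ⟨hb', ha'⟩
  refine ⟨t, interior_subset (hsub ht), (umed_eq_of_smoothDist_eq (hF.support t (hsub ht))
    (exists_half_le_distFun_dens _) ?_ hty).symm⟩
  exact (neg_half_lt_umed (exists_half_le_distFun_dens (F a))).trans_le h1

theorem differentiableWithinAt_distFun (hC1 : ∀ k : ℕ, ContDiffOn ℝ 1 (fun t => dens (F t) k) Θ)
    {θ : ℝ} (hθ : θ ∈ Θ) (k : ℤ) :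
    DifferentiableWithinAt ℝ (fun t => distFun (dens (F t)) k) Θ θ :=
  DifferentiableWithinAt.fun_sum fun j _ => (hC1 j).differentiableOn one_ne_zero θ hθ

theorem differentiableWithinAt_umed_formula
    (hC1 : ∀ k : ℕ, ContDiffOn ℝ 1 (fun t => dens (F t) k) Θ) {θ : ℝ} (hθ : θ ∈ Θ) (m : ℕ)
    (hm : dens (F θ) m ≠ 0) :
    DifferentiableWithinAt ℝ
      (fun t => (1 / 2 - distFun (dens (F t)) ((m : ℤ) - 1)) / dens (F t) m) Θ θ :=
  ((differentiableWithinAt_const _).sub (differentiableWithinAt_distFun hC1 hθ _)).fun_div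
    ((hC1 m).differentiableOn one_ne_zero θ hθ) hm

end Family

/-! ### Samples from the family and the reduction to sums. -/

section Sampling

variable {Ω : Type*} [MeasurableSpace Ω] {P : Measure Ω} [IsProbabilityMeasure P]

omit [IsProbabilityMeasure P] in
theorem integral_comp_ramp {Q : PMF ℕ} {X : Ω → ℕ} (hX : HasLaw X Q.toMeasure P) {f : ℝ → ℝ}
    (hf : f 0 = 0) {C : ℝ} (u : ℝ) (hC : ∀ k, |f (ramp u k)| ≤ C) :
    ∫ ω, f (ramp u (X ω)) ∂P = ∑ k ∈ Finset.range ⌈u + 1 / 2⌉₊, dens Q k * f (ramp u k) := by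
  have hint : Integrable (fun k => f (ramp u k)) Q.toMeasure :=
    .of_bound (measurable_of_countable _).aestronglyMeasurable C (.of_forall hC)
  have h1 : ∫ ω, f (ramp u (X ω)) ∂P = ∫ k, f (ramp u k) ∂Q.toMeasure := by
    rw [← hX.map_eq, integral_map hX.aemeasurable (measurable_of_countable _).aestronglyMeasurable]
  rw [h1, PMF.integral_eq_tsum _ _ hint]
  simp only [smul_eq_mul]
  refine tsum_eq_sum fun k hk => ?_
  rw [ramp_eq_zero (Nat.ceil_le.1 (by simpa using hk)), hf, mul_zero]

omit [IsProbabilityMeasure P] in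
theorem integral_ramp {Q : PMF ℕ} {X : Ω → ℕ} (hX : HasLaw X Q.toMeasure P) (u : ℝ) :
    ∫ ω, ramp u (X ω) ∂P = smoothDist (dens Q) u :=
  integral_comp_ramp hX (f := id) rfl (C := 1) u fun k => by
    simpa [abs_of_nonneg (ramp_nonneg u k)] using ramp_le_one u k

theorem variance_ramp {Q : PMF ℕ} {X : Ω → ℕ} (hX : HasLaw X Q.toMeasure P) (m : ℕ) {w : ℝ}
    (h0 : 0 ≤ w) (h1 : w ≤ 1) :
    Var[fun ω => ramp (m - 1 / 2 + w) (X ω); P] =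
      distFun (dens Q) ((m : ℤ) - 1) + w ^ 2 * dens Q m -
        (distFun (dens Q) ((m : ℤ) - 1) + w * dens Q m) ^ 2 := by
  have hb (u : ℝ) (k : ℕ) : |ramp u k| ≤ 1 := by
    simpa [abs_of_nonneg (ramp_nonneg u k)] using ramp_le_one u k
  rw [variance_eq_sub (memLp_comp_of_bounded hX.aemeasurable (measurable_of_countable _)
    (hb _) 2), integral_ramp hX, smoothDist_add _ m h0 h1]
  have := integral_comp_ramp hX (f := fun y => y ^ 2) (by norm_num) (C := 1) (m - 1 / 2 + w)
    fun k => by rw [abs_pow]; exact pow_le_one₀ (abs_nonneg _) (hb _ k)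
  simp only [Pi.pow_apply]
  rw [this, ← sum_range_mul_ramp_eq _ (fun y => y ^ 2) (by norm_num) (N := m + 1)
    (by push_cast; linarith)]
  rw [sum_range_succ_mul_ramp _ (fun y => y ^ 2) (by norm_num) m h0 h1]

variable {Θ : Set ℝ} {F : ℝ → PMF ℕ} {x : ℕ → Ω → ℕ}

omit [IsProbabilityMeasure P] in
theorem identDistrib_of_hasLaw {Q : PMF ℕ} (hlaw : ∀ i, HasLaw (x i) Q.toMeasure P) (i : ℕ) :
    IdentDistrib (x i) (x 0) P P :=
  ⟨(hlaw i).aemeasurable, (hlaw 0).aemeasurable, by rw [(hlaw i).map_eq, (hlaw 0).map_eq]⟩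

theorem ae_tendsto_smoothDist_empDens {Q : PMF ℕ} (hlaw : ∀ i, HasLaw (x i) Q.toMeasure P)
    (hindep : iIndepFun x P) (u : ℝ) :
    ∀ᵐ ω ∂P, Tendsto (fun n => smoothDist (empDens (fun i => x i ω) n) u) atTop
      (𝓝 (smoothDist (dens Q) u)) := by
  have hm : Measurable (ramp u) := measurable_of_countable _
  have h := strong_law_ae_real (μ := P) (fun i ω => ramp u (x i ω))
    ((memLp_comp_of_bounded (hlaw 0).aemeasurable hm (C := 1) (fun k => by
      simpa [abs_of_nonneg (ramp_nonneg u k)] using ramp_le_one u k) 1).integrable le_rfl)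
    (fun i j hij => (hindep.indepFun hij).comp hm hm)
    fun i => (identDistrib_of_hasLaw hlaw i).comp hm
  rw [integral_ramp (hlaw 0)] at h
  filter_upwards [h] with ω hω
  exact hω.congr fun n => (smoothDist_empDens _ n u).symm

/-- For `a < θ < b`, the strong law at the two points `g a` and `g b` eventually traps the empirical
median between them. -/
theorem ae_eventually_optEstimate (hF : IsRegularFamily Θ F)
    (hC : ∀ k, ContinuousOn (fun t => dens (F t) k) Θ) {θ : ℝ} (hθ : θ ∈ interior Θ)
    (hlaw : ∀ i, HasLaw (x i) (F θ).toMeasure P) (hindep : iIndepFun x P)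
    {θhat : ℕ → Ω → ℝ}
    (hest : ∀ n, 1 ≤ n → ∀ᵐ ω ∂P, IsOptEstimate Θ F (empDens (fun i => x i ω) n) (θhat n ω)) :
    ∀ᵐ ω ∂P, ∀ᶠ n in atTop, θhat n ω ∈ Θ ∧
      umed (empDens (fun i => x i ω) n) = umed (dens (F (θhat n ω))) := by
  obtain ⟨ε, hε, hball⟩ := Metric.isOpen_iff.1 isOpen_interior θ hθ
  have ha : θ - ε / 2 ∈ interior Θ := hball (by
    rw [Metric.mem_ball, Real.dist_eq, abs_lt]; constructor <;> linarith)
  have hb : θ + ε / 2 ∈ interior Θ := hball (by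
    rw [Metric.mem_ball, Real.dist_eq, abs_lt]; constructor <;> linarith)
  set a := θ - ε / 2
  set b := θ + ε / 2
  have hle (t : ℝ) := neg_half_lt_umed (exists_half_le_distFun_dens (F t))
  have ha' : smoothDist (dens (F θ)) (umed (dens (F a))) < 1 / 2 := by
    rw [← smoothDist_umed (exists_half_le_distFun_dens (F a))]
    exact hF.smoothDist_lt (interior_subset ha) (interior_subset hθ) (by simp [a, hε]) (hle a)
  have hb' : 1 / 2 < smoothDist (dens (F θ)) (umed (dens (F b))) := by
    conv_lhs => rw [← smoothDist_umed (exists_half_le_distFun_dens (F b))]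
    exact hF.smoothDist_lt (interior_subset hθ) (interior_subset hb) (by simp [b, hε]) (hle b)
  have hest' : ∀ᵐ ω ∂P, ∀ n, 1 ≤ n →
      IsOptEstimate Θ F (empDens (fun i => x i ω) n) (θhat n ω) := by
    rw [ae_all_iff]
    intro n
    by_cases hn : 1 ≤ n
    · filter_upwards [hest n hn] with ω hω using fun _ => hω
    · exact .of_forall fun ω h => absurd h hn
  filter_upwards [hest', ae_tendsto_smoothDist_empDens hlaw hindep (umed (dens (F a))),
    ae_tendsto_smoothDist_empDens hlaw hindep (umed (dens (F b)))] with ω h1 h2 h3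
  filter_upwards [h2.eventually_lt_const ha', h3.eventually_const_lt hb',
    eventually_ge_atTop 1] with n hna hnb hn
  have hhalf := exists_half_le_distFun (hasSum_empDens (fun i => x i ω) hn)
  refine h1 n hn (hF.exists_umed_eq hC ha hb (by simp only [a, b]; linarith) ?_ ?_)
  · by_contra! hlt
    exact absurd ((umed_le_iff (empDens_nonneg _ n) hhalf _).1 hlt.le) (not_le.2 hna)
  · exact (umed_le_iff (empDens_nonneg _ n) hhalf _).2 hnb.le

theorem tendsto_measure_estimate_le (hF : IsRegularFamily Θ F)
    (hC : ∀ k, ContinuousOn (fun t => dens (F t) k) Θ) {θ : ℝ} (hθ : θ ∈ interior Θ)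
    (hlaw : ∀ i, HasLaw (x i) (F θ).toMeasure P) (hindep : iIndepFun x P)
    {θhat : ℕ → Ω → ℝ} (hmeas : ∀ n, AEMeasurable (θhat n) P)
    (hest : ∀ n, 1 ≤ n → ∀ᵐ ω ∂P, IsOptEstimate Θ F (empDens (fun i => x i ω) n) (θhat n ω))
    {V : ℝ} (hV : Var[fun ω => ramp (umed (dens (F θ))) (x 0 ω); P] = V) (hV0 : V ≠ 0)
    {S : Set ℝ} {d : ℝ} (hg : ContinuousWithinAt (fun t => umed (dens (F t))) S θ)
    (hd : HasDerivWithinAt (fun t => smoothDist (dens (F θ)) (umed (dens (F t)))) d S θ)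
    {t : ℝ} (ht : ∀ᶠ n : ℕ in atTop, θ + (√n)⁻¹ * t ∈ S) :
    Tendsto (fun n : ℕ => P {ω | √n * (θhat n ω - θ) ≤ t}) atTop
      (𝓝 (gaussianReal 0 V.toNNReal (Set.Iic (d * t)))) := by
  set s : ℕ → ℝ := fun n => θ + (√n)⁻¹ * t with hs
  have hinv : Tendsto (fun n : ℕ => (√n)⁻¹ * t) atTop (𝓝 0) := by
    rw [← zero_mul t]
    exact (tendsto_inv_atTop_zero.comp (Real.tendsto_sqrt_atTop.comp
      tendsto_natCast_atTop_atTop)).mul_const t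
  have hsθ : Tendsto s atTop (𝓝 θ) := by simpa [hs] using hinv.const_add θ
  have hsS : Tendsto s atTop (𝓝[S] θ) := tendsto_nhdsWithin_iff.2 ⟨hsθ, ht⟩
  have hgs := hg.tendsto.comp hsS
  have hm (u : ℝ) : Measurable (ramp u) := measurable_of_countable _
  have hhalf := smoothDist_umed (exists_half_le_distFun_dens (F θ))
  have hlim : Tendsto (fun n : ℕ => √n * (smoothDist (dens (F θ)) (umed (dens (F (s n)))) -
      smoothDist (dens (F θ)) (umed (dens (F θ))))) atTop (𝓝 (d * t)) := by
    -- Differentiation along the increments `t / √n`, rescaled by `√n`; `S` may be a half-line,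
    -- which yields the one-sided versions.
    have := hd.hasFDerivWithinAt.lim (c := fun n : ℕ => √(n : ℝ)) (v := t) hinv ht
      (tendsto_const_nhds.congr' (by
        filter_upwards [eventually_ge_atTop 1] with n hn
        have : √(n : ℝ) ≠ 0 := (Real.sqrt_pos.2 (by exact_mod_cast hn)).ne'
        simp [this]))
    simpa [hs, mul_comm] using this
  have key := tendsto_measure_le_sum (f := fun n => ramp (umed (dens (F (s n)))))
    (f₀ := ramp (umed (dens (F θ)))) (ε := fun n => |umed (dens (F (s n))) - umed (dens (F θ))|)
    (c := d * t) (C := 1)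
    (identDistrib_of_hasLaw hlaw) hindep (fun n => hm _) (hm _)
    (fun k => by
      simpa [abs_of_nonneg (ramp_nonneg _ k)] using ramp_le_one _ k)
    (fun n k => abs_ramp_sub_le _ _ k)
    (by simpa using (hgs.sub_const (umed (dens (F θ)))).abs)
    (by rwa [hV])
    (by simpa only [integral_ramp (hlaw 0)] using hlim)
  rw [hV, integral_ramp (hlaw 0), hhalf] at key
  refine tendsto_measure_of_ae_eventually_iff (fun n => ?_) (fun n => ?_) ?_ key
  · exact nullMeasurableSet_le (((hmeas n).sub_const θ).const_mul _) aemeasurable_const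
  · exact nullMeasurableSet_le aemeasurable_const
      (Finset.aemeasurable_fun_sum _ fun i _ => (hm _).comp_aemeasurable (hlaw i).aemeasurable)
  · filter_upwards [ae_eventually_optEstimate hF hC hθ hlaw hindep hest] with ω hω
    filter_upwards [hω, eventually_ge_atTop 1,
      hsθ.eventually (mem_interior_iff_mem_nhds.1 hθ)] with n hn hn1 hsn
    have hn0 : (0 : ℝ) < n := by exact_mod_cast hn1
    have hn' : 0 < √(n : ℝ) := Real.sqrt_pos.2 hn0
    have h1 : √(n : ℝ) * (θhat n ω - θ) ≤ t ↔ θhat n ω ≤ s n := by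
      rw [hs, ← sub_le_iff_le_add', inv_mul_eq_div, le_div_iff₀' hn']
    have h2 : θhat n ω ≤ s n ↔ umed (dens (F (θhat n ω))) ≤ umed (dens (F (s n))) :=
      (hF.strictMonoOn_umed.le_iff_le hn.1 hsn).symm
    change √(n : ℝ) * (θhat n ω - θ) ≤ t ↔
      (n : ℝ) * (1 / 2) ≤ ∑ i ∈ Finset.range n, ramp (umed (dens (F (s n)))) (x i ω)
    rw [h1, h2, ← hn.2, umed_le_iff (empDens_nonneg _ n)
      (exists_half_le_distFun (hasSum_empDens _ hn1)), smoothDist_empDens, le_div_iff₀' hn0]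

end Sampling

/-! ### Gaussian scaling and the two-sided normal law. -/

theorem gaussianReal_Iic_mul {a : ℝ} (ha : 0 < a) (v : ℝ) (t : ℝ) :
    gaussianReal 0 (a ^ 2 * v).toNNReal (Set.Iic (a * t)) =
      gaussianReal 0 v.toNNReal (Set.Iic t) := by
  have h := gaussianReal_map_const_mul (μ := 0) (v := v.toNNReal) a
  have e : (a ^ 2 * v).toNNReal = NNReal.mk (a ^ 2) (sq_nonneg a) * v.toNNReal := by
    rw [Real.toNNReal_mul (sq_nonneg a), Real.toNNReal_of_nonneg (sq_nonneg a)]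
  rw [mul_zero, ← e] at h
  rw [← h, Measure.map_apply (by fun_prop) measurableSet_Iic]
  congr 1
  ext y
  simp [mul_le_mul_iff_right₀ ha]

theorem ofReal_Phi (t : ℝ) : ENNReal.ofReal (Phi t) = gaussianReal 0 1 (Set.Iic t) :=
  ofReal_cdf _ t

theorem exists_measure_cdf_eq_twoSidedPhi {a b : ℝ} (ha : 0 < a) (hb : 0 < b) :
    ∃ G : ProbabilityMeasure ℝ, ∀ t, cdf (G : Measure ℝ) t = twoSidedPhi a b t := by
  -- The inverse of `t ↦ a * t` (`t ≤ 0`), `b * t` (`t > 0`); the image of the standard normal law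
  -- under it is `G`.
  set ψ : ℝ → ℝ := fun y => if y ≤ 0 then y / a else y / b with hψ
  have hm : Measurable ψ :=
    .ite measurableSet_Iic (measurable_id.div_const a) (measurable_id.div_const b)
  refine ⟨⟨(gaussianReal 0 1).map ψ, Measure.isProbabilityMeasure_map hm.aemeasurable⟩,
    fun t => ?_⟩
  have := Measure.isProbabilityMeasure_map (μ := gaussianReal 0 1) hm.aemeasurable
  rw [ProbabilityMeasure.coe_mk, cdf_eq_real, map_measureReal_apply hm measurableSet_Iic,
    twoSidedPhi]
  have key (c : ℝ) (hc : ∀ y, ψ y ≤ t ↔ y ≤ c) :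
      (gaussianReal 0 1).real (ψ ⁻¹' Set.Iic t) = Phi c := by
    rw [Phi, cdf_eq_real]
    congr 1
    ext y
    exact hc y
  split_ifs with h
  · refine key _ fun y => ?_
    simp only [hψ]
    split_ifs with hy
    · rw [div_le_iff₀' ha]
    · have h1 : 0 < y / b := div_pos (not_le.1 hy) hb
      have h2 : a * t ≤ 0 := mul_nonpos_of_nonneg_of_nonpos ha.le h
      constructor <;> intro <;> linarith [not_le.1 hy]
  · refine key _ fun y => ?_
    simp only [hψ]
    split_ifs with hy
    · have h1 : y / a ≤ 0 := div_nonpos_of_nonpos_of_nonneg hy ha.le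
      have h2 : 0 < b * t := mul_pos hb (not_le.1 h)
      constructor <;> intro <;> linarith [not_le.1 h]
    · rw [div_le_iff₀' hb]

/-! ### Derivative of the uniform median and the variance of the ramp. -/

section Family

variable {Θ : Set ℝ} {F : ℝ → PMF ℕ}

/-- `F(K - 1) < 1/2 < F(K)` is an open condition, so `k₀` is locally constant. -/
theorem exists_hasDerivWithinAt_umed
    (hC1 : ∀ k : ℕ, ContDiffOn ℝ 1 (fun t => dens (F t) k) Θ) {θ : ℝ} (hθ : θ ∈ Θ)
    (hlt : 1 / 2 < distFun (dens (F θ)) (k₀ (dens (F θ)))) :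
    (∀ᶠ t in 𝓝[Θ] θ, k₀ (dens (F t)) = k₀ (dens (F θ))) ∧
      ∃ g', HasDerivWithinAt (fun t => umed (dens (F t))) g' Θ θ := by
  set K := k₀ (dens (F θ)) with hK
  have hp : dens (F θ) K ≠ 0 := (apply_k₀_pos (exists_half_le_distFun_dens (F θ))).ne'
  have hcont (k : ℤ) := (differentiableWithinAt_distFun hC1 hθ k).continuousWithinAt.tendsto
  have hev : ∀ᶠ t in 𝓝[Θ] θ, k₀ (dens (F t)) = K := by
    filter_upwards [(hcont K).eventually_const_lt hlt,
      (hcont (K - 1)).eventually_lt_const (distFun_k₀_sub_one_lt (dens (F θ)))] with t h1 h2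
    exact k₀_eq (dens_nonneg _) h1.le h2
  refine ⟨hev, _, (((differentiableWithinAt_umed_formula hC1 hθ K hp).const_add
    ((K : ℝ) - 1 / 2)).hasDerivWithinAt).congr_of_eventuallyEq ?_ (umed_eq_of_k₀_eq hK.symm)⟩
  exact hev.mono fun t ht => umed_eq_of_k₀_eq ht

theorem nonneg_of_hasDerivWithinAt_umed (hF : IsRegularFamily Θ F) {θ a b g' : ℝ} {S : Set ℝ}
    (ha : a ∈ Θ) (hb : b ∈ Θ) (hab : a < b) (hθ : θ ∈ Set.Icc a b) (hS : Set.Icc a b ⊆ S)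
    (h : HasDerivWithinAt (fun t => umed (dens (F t))) g' S θ) : 0 ≤ g' := by
  refine (h.mono hS).nonneg_of_monotoneOn ?_
    (hF.strictMonoOn_umed.monotoneOn.mono (hF.interval.out ha hb))
  have := (uniqueDiffOn_Icc hab θ hθ).accPt
  exact this

/-- Cauchy–Schwarz gives `(A + w p)² ≤ (A + w² p)(A + p)`, and `A + p < 1` because `m + 1` has
positive mass. -/
theorem variance_ne_zero_of_lt {Q : PMF ℕ} {m : ℕ} (hQ : ∀ k, 0 < dens Q k) {w : ℝ} (hw : 0 < w)
    (h : distFun (dens Q) ((m : ℤ) - 1) + w * dens Q m = 1 / 2) :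
    distFun (dens Q) ((m : ℤ) - 1) + w ^ 2 * dens Q m - (1 / 2) ^ 2 ≠ 0 := by
  have h1 := distFun_dens_le_one Q ((m + 1 : ℕ) : ℤ)
  rw [distFun_natCast, Finset.sum_range_succ, ← distFun_natCast, distFun_eq_add] at h1
  have hm := hQ m
  have hm1 := hQ (m + 1)
  have hA : 0 ≤ distFun (dens Q) ((m : ℤ) - 1) := Finset.sum_nonneg fun i _ => dens_nonneg Q i
  generalize distFun (dens Q) ((m : ℤ) - 1) = A at *
  generalize dens Q m = p at *
  have hpos : 0 < A + w ^ 2 * p := by positivity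
  have hlt : (A + w ^ 2 * p) * (A + p) < A + w ^ 2 * p := by nlinarith
  have hcs : (A + w * p) ^ 2 ≤ (A + w ^ 2 * p) * (A + p) := by
    nlinarith [mul_nonneg (mul_nonneg hA hm.le) (sq_nonneg (1 - w))]
  rw [h] at hcs
  linarith

theorem sq_mul_sigmaSq (Q : PMF ℕ) {w : ℝ}
    (h : distFun (dens Q) ((k₀ (dens Q) : ℤ) - 1) + w * dens Q (k₀ (dens Q)) = 1 / 2) :
    dens Q (k₀ (dens Q)) ^ 2 * sigmaSq (dens Q) =
      distFun (dens Q) ((k₀ (dens Q) : ℤ) - 1) + w ^ 2 * dens Q (k₀ (dens Q)) - (1 / 2) ^ 2 := by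
  have hp := apply_k₀_pos (exists_half_le_distFun_dens Q)
  rw [sigmaSq]
  generalize distFun (dens Q) ((k₀ (dens Q) : ℤ) - 1) = A at *
  generalize dens Q (k₀ (dens Q)) = p at *
  obtain rfl : A = 1 / 2 - w * p := by linarith
  field_simp
  ring

end Family

/-! ### The normal limit (a). -/

section Estimate

variable {Ω : Type*} [MeasurableSpace Ω] {P : Measure Ω} [IsProbabilityMeasure P]
  {Θ : Set ℝ} {F : ℝ → PMF ℕ} {x : ℕ → Ω → ℕ} {θ : ℝ} {θhat : ℕ → Ω → ℝ}

omit [IsProbabilityMeasure P] in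
theorem ae_estimate_eq_of_dens_zero_eq_one (hF : IsRegularFamily Θ F) (hθ : θ ∈ Θ)
    (h0 : dens (F θ) 0 = 1) (hlaw : ∀ i, HasLaw (x i) (F θ).toMeasure P) {n : ℕ} (hn : 1 ≤ n)
    (hest : ∀ᵐ ω ∂P, IsOptEstimate Θ F (empDens (fun i => x i ω) n) (θhat n ω)) :
    ∀ᵐ ω ∂P, θhat n ω = θ := by
  have hx : ∀ᵐ ω ∂P, ∀ i, x i ω = 0 := by
    rw [ae_all_iff]
    intro i
    rw [(hlaw i).ae_iff (p := fun k => k = 0) (measurable_of_countable _), ae_iff_of_countable]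
    intro k hk
    by_contra hk0
    rw [PMF.toMeasure_apply_singleton _ _ (measurableSet_singleton k)] at hk
    have := dens_eq_zero_of_dens_zero_eq_one h0 hk0
    exact hk (((ENNReal.toReal_eq_zero_iff _).1 this).resolve_right ((F θ).apply_ne_top k))
  filter_upwards [hx, hest] with ω hω h
  have e : empDens (fun i => x i ω) n = dens (F θ) := by
    funext k
    rw [empDens_eq_sum]
    simp only [hω, Finset.sum_const, Finset.card_range, nsmul_eq_mul]
    have hn' : (n : ℝ) ≠ 0 := by positivity
    rcases eq_or_ne k 0 with rfl | hk
    · simp [h0, hn']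
    · simp [dens_eq_zero_of_dens_zero_eq_one h0 hk, hk.symm]
  rw [e] at h
  obtain ⟨h1, h2⟩ := h ⟨θ, hθ, rfl⟩
  exact (hF.strictMonoOn_umed.injOn hθ h1 h2).symm

theorem tendstoInDistribution_estimate_of_dens_zero_eq_one (hF : IsRegularFamily Θ F) (hθ : θ ∈ Θ)
    (h0 : dens (F θ) 0 = 1) (hlaw : ∀ i, HasLaw (x i) (F θ).toMeasure P)
    (hest : ∀ n, 1 ≤ n → ∀ᵐ ω ∂P, IsOptEstimate Θ F (empDens (fun i => x i ω) n) (θhat n ω)) :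
    TendstoInDistribution (fun (n : ℕ) ω => √(n : ℝ) * (θhat n ω - θ)) atTop (id : ℝ → ℝ)
      (fun _ => P) (gaussianReal 0 0) := by
  have hz (n : ℕ) : (fun _ : Ω => (0 : ℝ)) =ᵐ[P] fun ω => √(n : ℝ) * (θhat n ω - θ) := by
    rcases Nat.eq_zero_or_pos n with rfl | hn
    · simp
    · filter_upwards [ae_estimate_eq_of_dens_zero_eq_one hF hθ h0 hlaw hn (hest n hn)] with ω hω
      simp [hω]
  refine tendstoInDistribution_of_identDistrib 0 (fun n => ?_) ?_
  · exact (IdentDistrib.of_ae_eq aemeasurable_const ((hz 0))).symm.trans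
      (IdentDistrib.of_ae_eq aemeasurable_const (hz n))
  · refine (IdentDistrib.of_ae_eq aemeasurable_const (hz 0)).symm.trans
      ⟨aemeasurable_const, aemeasurable_id, ?_⟩
    simp

theorem tendstoInDistribution_estimate (hF : IsRegularFamily Θ F)
    (hC1 : ∀ k : ℕ, ContDiffOn ℝ 1 (fun t => dens (F t) k) Θ) (hθ : θ ∈ Θ)
    (hlaw : ∀ i, HasLaw (x i) (F θ).toMeasure P) (hindep : iIndepFun x P)
    (hmeas : ∀ n, AEMeasurable (θhat n) P)
    (hest : ∀ n, 1 ≤ n → ∀ᵐ ω ∂P, IsOptEstimate Θ F (empDens (fun i => x i ω) n) (θhat n ω))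
    (hlt : 1 / 2 < distFun (dens (F θ)) (k₀ (dens (F θ)))) {g' : ℝ}
    (hg : HasDerivWithinAt (fun t => umed (dens (F t))) g' Θ θ) (hg' : g' ≠ 0) :
    TendstoInDistribution (fun (n : ℕ) ω => √(n : ℝ) * (θhat n ω - θ)) atTop (id : ℝ → ℝ)
      (fun _ => P) (gaussianReal 0 (sigmaSq (dens (F θ)) / g' ^ 2).toNNReal) := by
  rcases hF.exists_lt_or hθ with ⟨a, ha, haθ⟩ | h0
  swap
  · simpa [sigmaSq_eq_zero_of_dens_zero_eq_one h0] using
      tendstoInDistribution_estimate_of_dens_zero_eq_one hF hθ h0 hlaw hest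
  obtain ⟨b, hb, hθb⟩ := hF.exists_gt hθ
  have hint := hF.mem_interior ha hb haθ hθb
  have hhalf (t : ℝ) := exists_half_le_distFun_dens (F t)
  have hpos : 0 < g' := lt_of_le_of_ne (nonneg_of_hasDerivWithinAt_umed hF ha hb
    (haθ.trans hθb) ⟨haθ.le, hθb.le⟩ (hF.interval.out ha hb) hg) hg'.symm
  have hev := (exists_hasDerivWithinAt_umed hC1 hθ hlt).1
  have hd := hasDerivWithinAt_smoothDist_comp (dens (F θ)) _ hg
    (hev.mono fun t ht => umed_mem_of_k₀_eq (hhalf t) ht) (umed_mem_of_k₀_eq (hhalf θ) rfl)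
  obtain ⟨w, hw, hw1, hwe, hwF⟩ := exists_umed_eq (hhalf θ)
  have hp := apply_k₀_pos (hhalf θ)
  have hV := variance_ramp (hlaw 0) (k₀ (dens (F θ))) hw.le hw1
  rw [← hwe, hwF, ← sq_mul_sigmaSq _ hwF] at hV
  have hV0 := variance_ne_zero_of_lt (hF.support θ hint) hw hwF
  rw [← sq_mul_sigmaSq _ hwF] at hV0
  refine tendstoInDistribution_of_tendsto_measure_le
    (fun n => ((hmeas n).sub_const θ).const_mul _) _ fun t => ?_
  have hlim : Tendsto (fun n : ℕ => θ + (√n)⁻¹ * t) atTop (𝓝 θ) := by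
    have := ((tendsto_inv_atTop_zero.comp (Real.tendsto_sqrt_atTop.comp
      tendsto_natCast_atTop_atTop)).mul_const t).const_add θ
    simpa using this
  have := tendsto_measure_estimate_le hF (fun k => (hC1 k).continuousOn) hint hlaw hindep hmeas
    hest hV hV0 hg.continuousWithinAt hd (hlim.eventually (mem_interior_iff_mem_nhds.1 hint))
  -- Scaling by `d = g' p₀` turns `σ² / g'²` into the ramp variance `p₀² σ²`.
  rw [← gaussianReal_Iic_mul (mul_pos hpos hp)]
  convert this using 4
  field_simp

end Estimate

/-! ### One-sided derivatives when `F(K) = 1/2`. -/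

section Atom

variable {Θ : Set ℝ} {F : ℝ → PMF ℕ} {θ : ℝ}

theorem IsRegularFamily.mem_interior_of_distFun_k₀_eq_half (hF : IsRegularFamily Θ F) (hθ : θ ∈ Θ)
    (h : distFun (dens (F θ)) (k₀ (dens (F θ))) = 1 / 2) : θ ∈ interior Θ := by
  rcases hF.exists_lt_or hθ with ⟨a, ha, haθ⟩ | h0
  · obtain ⟨b, hb, hθb⟩ := hF.exists_gt hθ
    exact hF.mem_interior ha hb haθ hθb
  · rw [k₀_eq_zero_of_dens_zero_eq_one h0, distFun_natCast] at h
    norm_num [h0] at h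

/-- To the left of `θ`, `F_t(K) ≥ 1/2` by monotonicity, so `k₀` stays at `K`. -/
theorem hasDerivWithinAt_umed_Iic (hF : IsRegularFamily Θ F)
    (hC1 : ∀ k : ℕ, ContDiffOn ℝ 1 (fun t => dens (F t) k) Θ) (hθ : θ ∈ Θ) {K : ℕ}
    (hK : k₀ (dens (F θ)) = K) (h : distFun (dens (F θ)) K = 1 / 2) :
    (∀ᶠ t in 𝓝[Set.Iic θ] θ, k₀ (dens (F t)) = K) ∧ ∃ g',
      HasDerivWithinAt
        (fun t => (1 / 2 - distFun (dens (F t)) ((K : ℤ) - 1)) / dens (F t) K) g' (Set.Iic θ) θ ∧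
      HasDerivWithinAt (fun t => umed (dens (F t))) g' (Set.Iic θ) θ := by
  subst hK
  set K := k₀ (dens (F θ)) with hK
  have hint := mem_interior_iff_mem_nhds.1 (hF.mem_interior_of_distFun_k₀_eq_half hθ h)
  have hp : dens (F θ) K ≠ 0 := (apply_k₀_pos (exists_half_le_distFun_dens (F θ))).ne'
  have hcont := ((differentiableWithinAt_distFun hC1 hθ (K - 1)).differentiableAt
    hint).continuousAt.tendsto
  have hev : ∀ᶠ t in 𝓝[Set.Iic θ] θ, k₀ (dens (F t)) = K := by
    filter_upwards [nhdsWithin_le_nhds (hcont.eventually_lt_const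
      (distFun_k₀_sub_one_lt (dens (F θ)))), nhdsWithin_le_nhds hint, self_mem_nhdsWithin]
      with t h1 h2 h3
    exact k₀_eq (dens_nonneg _) (h ▸ (hF.decreasing K).antitoneOn h2 hθ h3) h1
  have hd := ((differentiableWithinAt_umed_formula hC1 hθ K hp).differentiableAt
    hint).hasDerivAt.hasDerivWithinAt (s := Set.Iic θ)
  exact ⟨hev, _, hd, (hd.const_add ((K : ℝ) - 1 / 2)).congr_of_eventuallyEq
    (hev.mono fun t ht => umed_eq_of_k₀_eq ht) (umed_eq_of_k₀_eq hK.symm)⟩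

theorem umed_eq_of_distFun_k₀_eq_half {p : ℕ → ℝ} (h1 : ∃ k : ℕ, 1 / 2 ≤ distFun p k) {K : ℕ}
    (hK : k₀ p = K) (h : distFun p K = 1 / 2) : umed p = K - 1 / 2 + 1 := by
  subst hK
  have hp := apply_k₀_pos h1
  rw [distFun_eq_add] at h
  rw [umed, show 1 / 2 - distFun p ((k₀ p : ℤ) - 1) = p (k₀ p) by linarith, div_self hp.ne']

/-- To the right, `F_t(K) < 1/2` and `k₀` jumps to `K + 1`. At `θ` itself `k₀ = K`, yet the formula
for `K + 1` also gives `K + 1/2`, so it holds on a right neighbourhood including `θ`. -/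
theorem hasDerivWithinAt_umed_Ici (hF : IsRegularFamily Θ F)
    (hC1 : ∀ k : ℕ, ContDiffOn ℝ 1 (fun t => dens (F t) k) Θ) (hθ : θ ∈ Θ) {K : ℕ}
    (hK : k₀ (dens (F θ)) = K) (h : distFun (dens (F θ)) K = 1 / 2) :
    (∀ᶠ t in 𝓝[Set.Ioi θ] θ, k₀ (dens (F t)) = K + 1) ∧ ∃ g',
      HasDerivWithinAt
        (fun t => (1 / 2 - distFun (dens (F t)) K) / dens (F t) (K + 1)) g' (Set.Ici θ) θ ∧
      HasDerivWithinAt (fun t => umed (dens (F t))) g' (Set.Ici θ) θ := by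
  have hint := hF.mem_interior_of_distFun_k₀_eq_half hθ (hK ▸ h)
  have hp := hF.support θ hint (K + 1)
  have hint' := mem_interior_iff_mem_nhds.1 hint
  have e : ((K + 1 : ℕ) : ℤ) - 1 = K := by omega
  have hgt : 1 / 2 < distFun (dens (F θ)) (K + 1 : ℕ) := by
    rw [distFun_eq_add, e, h]; linarith
  have hcont := ((differentiableWithinAt_distFun hC1 hθ (K + 1 : ℕ)).differentiableAt
    hint').continuousAt.tendsto
  have hev : ∀ᶠ t in 𝓝[Set.Ioi θ] θ, k₀ (dens (F t)) = K + 1 := by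
    filter_upwards [nhdsWithin_le_nhds (hcont.eventually_const_lt hgt),
      nhdsWithin_le_nhds hint', self_mem_nhdsWithin] with t h1 h2 h3
    refine k₀_eq (dens_nonneg _) h1.le ?_
    rw [e, ← h]
    exact hF.decreasing K hθ h2 h3
  have hd := ((differentiableWithinAt_umed_formula hC1 hθ (K + 1) hp.ne').differentiableAt
    hint').hasDerivAt.hasDerivWithinAt (s := Set.Ici θ)
  rw [e] at hd
  have hθeq : umed (dens (F θ)) = ((K + 1 : ℕ) : ℝ) - 1 / 2 +
      (1 / 2 - distFun (dens (F θ)) K) / dens (F θ) (K + 1) := by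
    rw [umed_eq_of_distFun_k₀_eq_half (exists_half_le_distFun_dens _) hK h, h]
    push_cast; ring
  refine ⟨hev, _, hd, (hd.const_add (((K + 1 : ℕ) : ℝ) - 1 / 2)).congr_of_eventuallyEq ?_ hθeq⟩
  rw [← Set.Ioi_insert, nhdsWithin_insert]
  refine eventually_sup.2 ⟨eventually_pure.2 hθeq, hev.mono fun t ht => ?_⟩
  have := umed_eq_of_k₀_eq ht
  rwa [e] at this

end Atom

/-! ### The two-sided limit (b). -/

section Estimate

variable {Ω : Type*} [MeasurableSpace Ω] {P : Measure Ω} [IsProbabilityMeasure P]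
  {Θ : Set ℝ} {F : ℝ → PMF ℕ} {x : ℕ → Ω → ℕ} {θ : ℝ} {θhat : ℕ → Ω → ℝ}

theorem tendstoInDistribution_estimate_of_distFun_eq_half (hF : IsRegularFamily Θ F)
    (hC1 : ∀ k : ℕ, ContDiffOn ℝ 1 (fun t => dens (F t) k) Θ) (hθ : θ ∈ Θ)
    (hlaw : ∀ i, HasLaw (x i) (F θ).toMeasure P) (hindep : iIndepFun x P)
    (hmeas : ∀ n, AEMeasurable (θhat n) P)
    (hest : ∀ n, 1 ≤ n → ∀ᵐ ω ∂P, IsOptEstimate Θ F (empDens (fun i => x i ω) n) (θhat n ω))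
    {K : ℕ} (hK : k₀ (dens (F θ)) = K) (h : distFun (dens (F θ)) K = 1 / 2) {gm gp : ℝ}
    (hgm : HasDerivWithinAt (fun t => umed (dens (F t))) gm (Set.Iic θ) θ)
    (hgp : HasDerivWithinAt (fun t => umed (dens (F t))) gp (Set.Ici θ) θ)
    (hgm0 : gm ≠ 0) (hgp0 : gp ≠ 0) :
    ∃ G : ProbabilityMeasure ℝ,
      (∀ t : ℝ, cdf (G : Measure ℝ) t =
        twoSidedPhi (2 * gm * dens (F θ) K) (2 * gp * dens (F θ) (K + 1)) t) ∧
      TendstoInDistribution (fun (n : ℕ) ω => √(n : ℝ) * (θhat n ω - θ)) atTop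
        (id : ℝ → ℝ) (fun _ => P) (G : Measure ℝ) := by
  have hint := hF.mem_interior_of_distFun_k₀_eq_half hθ (hK ▸ h)
  have hhalf (t : ℝ) := exists_half_le_distFun_dens (F t)
  obtain ⟨ε, hε, hball⟩ := Metric.isOpen_iff.1 isOpen_interior θ hint
  have hmem (y : ℝ) (hy : |y| < ε) : θ + y ∈ Θ :=
    interior_subset (hball (by simpa [Real.dist_eq] using hy))
  have hΘm := hmem (-(ε / 2)) (by rw [abs_neg, abs_of_pos] <;> linarith)
  have hΘp := hmem (ε / 2) (by rw [abs_of_pos] <;> linarith)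
  have hgm1 : 0 < gm := lt_of_le_of_ne (nonneg_of_hasDerivWithinAt_umed hF hΘm hθ
    (by linarith) ⟨by linarith, le_rfl⟩ (fun y hy => hy.2) hgm) hgm0.symm
  have hgp1 : 0 < gp := lt_of_le_of_ne (nonneg_of_hasDerivWithinAt_umed hF hθ hΘp
    (by linarith) ⟨le_rfl, by linarith⟩ (fun y hy => hy.1) hgp) hgp0.symm
  have hpK := hF.support θ hint K
  have hpK1 := hF.support θ hint (K + 1)
  have hu := umed_eq_of_distFun_k₀_eq_half (hhalf θ) hK h
  have hdm := hasDerivWithinAt_smoothDist_comp (dens (F θ)) K hgm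
    ((hasDerivWithinAt_umed_Iic hF hC1 hθ hK h).1.mono fun t ht =>
      umed_mem_of_k₀_eq (hhalf t) ht) (umed_mem_of_k₀_eq (hhalf θ) hK)
  have hθp : ((K + 1 : ℕ) : ℝ) - 1 / 2 ≤ umed (dens (F θ)) ∧
      umed (dens (F θ)) ≤ ((K + 1 : ℕ) : ℝ) + 1 / 2 := by
    rw [hu]; push_cast; constructor <;> linarith
  have hdp := hasDerivWithinAt_smoothDist_comp (dens (F θ)) (K + 1) hgp (by
    rw [← Set.Ioi_insert, nhdsWithin_insert]
    exact eventually_sup.2 ⟨eventually_pure.2 hθp,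
      (hasDerivWithinAt_umed_Ici hF hC1 hθ hK h).1.mono fun t ht =>
        umed_mem_of_k₀_eq (hhalf t) ht⟩) hθp
  -- Here `w = 1`: the ramp is the indicator of `k ≤ K`, with variance `1/4`. This is the source of
  -- the factor `2` in `G`.
  have hV := variance_ramp (hlaw 0) K zero_le_one le_rfl
  rw [← hu, one_pow, one_mul, ← distFun_eq_add, h,
    show (1 / 2 : ℝ) - (1 / 2) ^ 2 = 1 / 4 by norm_num] at hV
  obtain ⟨G, hG⟩ := exists_measure_cdf_eq_twoSidedPhi
    (mul_pos (mul_pos two_pos hgm1) hpK) (mul_pos (mul_pos two_pos hgp1) hpK1)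
  refine ⟨G, hG, tendstoInDistribution_of_tendsto_measure_le
    (fun n => ((hmeas n).sub_const θ).const_mul _) _ fun t => ?_⟩
  have hscale (c : ℝ) : gaussianReal 0 (1 / 4 : ℝ).toNNReal (Set.Iic c) =
      ENNReal.ofReal (Phi (2 * c)) := by
    rw [ofReal_Phi, ← gaussianReal_Iic_mul two_pos]
    norm_num
  have hsign (n : ℕ) : 0 ≤ (√(n : ℝ))⁻¹ := by positivity
  rw [← ofReal_cdf, hG, twoSidedPhi]
  split_ifs with ht
  · have := tendsto_measure_estimate_le hF (fun k => (hC1 k).continuousOn) hint hlaw hindep hmeas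
      hest hV (by norm_num) hgm.continuousWithinAt hdm (t := t) (.of_forall fun n => by
        have := mul_nonpos_of_nonneg_of_nonpos (hsign n) ht
        simpa using this)
    rw [hscale] at this
    convert this using 4
    ring
  · have := tendsto_measure_estimate_le hF (fun k => (hC1 k).continuousOn) hint hlaw hindep hmeas
      hest hV (by norm_num) hgp.continuousWithinAt hdp (t := t) (.of_forall fun n => by
        have := mul_nonneg (hsign n) (not_le.1 ht).le
        simpa using this)
    rw [hscale] at this
    convert this using 4
    ring

end Estimate

end UMed

end

theorem mainTheorem3 (Θ : Set ℝ) (F : ℝ → PMF ℕ) (hF : UMed.IsRegularFamily Θ F)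
    (hC1 : ∀ k : ℕ, ContDiffOn ℝ 1 (fun t => UMed.dens (F t) k) Θ)
    (θ : ℝ) (hθ : θ ∈ Θ)
    {Ω : Type*} [MeasurableSpace Ω] (P : Measure Ω) [IsProbabilityMeasure P]
    (x : ℕ → Ω → ℕ) (hlaw : ∀ i, HasLaw (x i) (F θ).toMeasure P) (hindep : iIndepFun x P)
    (θhat : ℕ → Ω → ℝ) (hmeas : ∀ n, AEMeasurable (θhat n) P)
    (hest : ∀ n, 1 ≤ n → ∀ᵐ ω ∂P,
      UMed.IsOptEstimate Θ F (UMed.empDens (fun i => x i ω) n) (θhat n ω))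
    (g : ℝ → ℝ) (hg : g = fun t => UMed.umed (UMed.dens (F t)))
    (K : ℕ) (hK : K = UMed.k₀ (UMed.dens (F θ))) :
    (1 / 2 < UMed.distFun (UMed.dens (F θ)) K →
      ∃ g' : ℝ, HasDerivWithinAt g g' Θ θ ∧
        (g' ≠ 0 →
          TendstoInDistribution (fun (n : ℕ) ω => √(n : ℝ) * (θhat n ω - θ)) atTop
            (id : ℝ → ℝ) (fun _ => P)
            (gaussianReal 0 (UMed.sigmaSq (UMed.dens (F θ)) / g' ^ 2).toNNReal))) ∧
    (UMed.distFun (UMed.dens (F θ)) K = 1 / 2 →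
      ∃ gm gp : ℝ,
        HasDerivWithinAt g gm (Set.Iic θ) θ ∧
        HasDerivWithinAt g gp (Set.Ici θ) θ ∧
        HasDerivWithinAt
          (fun t => (1 / 2 - UMed.distFun (UMed.dens (F t)) ((K : ℤ) - 1)) / UMed.dens (F t) K)
          gm (Set.Iic θ) θ ∧
        HasDerivWithinAt
          (fun t => (1 / 2 - UMed.distFun (UMed.dens (F t)) K) / UMed.dens (F t) (K + 1))
          gp (Set.Ici θ) θ ∧
        (gm ≠ 0 → gp ≠ 0 →
          ∃ G : ProbabilityMeasure ℝ,
            (∀ t : ℝ, cdf (G : Measure ℝ) t =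
              UMed.twoSidedPhi (2 * gm * UMed.dens (F θ) K) (2 * gp * UMed.dens (F θ) (K + 1)) t) ∧
            TendstoInDistribution (fun (n : ℕ) ω => √(n : ℝ) * (θhat n ω - θ)) atTop
              (id : ℝ → ℝ) (fun _ => P) (G : Measure ℝ))) := by
  subst hg
  constructor
  · intro hlt
    rw [hK] at hlt
    obtain ⟨-, g', hg'⟩ := UMed.exists_hasDerivWithinAt_umed hC1 hθ hlt
    exact ⟨g', hg', UMed.tendstoInDistribution_estimate hF hC1 hθ hlaw hindep hmeas hest hlt hg'⟩
  · intro h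
    obtain ⟨-, gm, hm, hgm⟩ := UMed.hasDerivWithinAt_umed_Iic hF hC1 hθ hK.symm h
    obtain ⟨-, gp, hp, hgp⟩ := UMed.hasDerivWithinAt_umed_Ici hF hC1 hθ hK.symm h
    exact ⟨gm, gp, hgm, hgp, hm, hp, UMed.tendstoInDistribution_estimate_of_distFun_eq_half hF hC1
      hθ hlaw hindep hmeas hest hK.symm h hgm hgp⟩
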